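/- **Setting.** Let $G$ be a countable discrete group and let $\mathcal T=(C_n,F_{n-1},\kappa_n,\nu_{n-1})_{n=1}^\infty$ be a sequence of $(C,F)$-parameters: $C_n,F_n\subset G$ are finite sets with $F_0=\{1\}$, $1\in F_n\cap C_n$, $\#C_n>1$, $F_nC_{n+1}\subset F_{n+1}$ and $F_nc\cap F_nc'=\emptyset$ for distinct $c,c'\in C_{n+1}$; $\kappa_n$ is a probability measure on $C_n$ charging every point, with $\prod_{n\ge1}\max_{c\in C_n}\kappa_n(c)=0$; $\nu_n$ is a finite measure on $F_n$ charging every point, with $\nu_0=\delta_1$ and $\nu_{n+1}(fc)=\nu_n(f)\kappa_{n+1}(c)$ for $f\in F_n$, $c\in C_{n+1}$; and $\lim_{m\to\infty}\nu_m\big((F_nC_{n+1}\cdots C_m)\cap g^{-1}F_m\big)=\nu_n(F_n)$ for all $g\in G$, $n\ge0$. Let $X$ be the inductive limit of the spaces $X_n=F_n\times C_{n+1}\times C_{n+2}\times\cdots$ along the embeddings $(f,c_{n+1},c_{n+2},\dots)\mapsto(fc_{n+1},c_{n+2},\dots)$ of $X_n$ into $X_{n+1}$. Let $\mu$ be the $\sigma$-finite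 Borel measure on $X$ whose restriction to each $X_n$ is $\nu_n\otimes\kappa_{n+1}\otimes\kappa_{n+2}\otimes\cdots$. The nonsingular $(C,F)$-action $T=(T_g)_{g\in G}$ associated with $\mathcal T$ is defined $\mu$-almost everywhere on $X$ by $T_g(f,c_{n+1},c_{n+2},\dots)=(gf,c_{n+1},c_{n+2},\dots)$ if $f,gf\in F_n$. By an *odometer sequence* we mean a sequence $\Gamma_1\supsetneq\Gamma_2\supsetneq\cdots$ of finite index subgroups of $G$ with $\bigcap_{n}\bigcap_{g\in G}g\Gamma_ng^{-1}=\{1\}$. A *nonsingular odometer* is the projective limit $Y=\varprojlim G/\Gamma_n$ of such a sequence with the action of $G$ by left translations, endowed with a nonzero $\sigma$-finite Borel measure $\nu$ that is quasi-invariant and ergodic. It is a *factor* of $T$ if there is a measurable map $\pi:X\to Y$ such that, for every $g\in G$, $\pi(T_gx)=g\pi(x)$ for $\mu$-a.e. $x$, and such that $\mu\circ\pi^{-1}$ and $\nu$ have the same null sets. **Corollary 4.6.** The following are equivalent: 1. $T$ has no nonsingular odometer factor; 2. for each odometer sequence $(\Gamma_n)_{n\ge1}$ no telescoping of $\mathcal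 T$ is compatible with $(\Gamma_n)_{n\ge1}$, i.e. for all integers $0=q_0<q_1<q_2<\cdots$, $$\sum_{n=1}^\infty\big(\kappa_{q_{n-1}+1}*\cdots*\kappa_{q_n}\big)\big(\{c\in C_{q_{n-1}+1}\cdots C_{q_n}\mid c\notin\Gamma_n\}\big)=\infty.$$ Moreover, if $\bigcap_n\Gamma_n$ is finite for every odometer sequence in $G$ (for example, if $G$ is Abelian), then 2 is also equivalent to 1'. $T$ has no nonsingular odometer factor with a non-atomic measure $\nu$. **Corollary 4.7.** For an increasing sequence of integers $0=q_0<q_1<\cdots$, the $\boldsymbol q$-telescoping of $\mathcal T$ consists of $\widetilde C_n=C_{q_{n-1}+1}\cdots C_{q_n}$, $\widetilde F_n=F_{q_n}$, $\widetilde\kappa_n=\kappa_{q_{n-1}+1}*\cdots*\kappa_{q_n}$, $\widetilde\nu_n=\nu_{q_n}$; it is compatible with $(\Gamma_n)_{n\ge1}$ if $\sum_{n\ge1}\widetilde\kappa_n(\{c\in\widetilde C_n\mid c\notin\Gamma_n\})<\infty$. $T$ is isomorphic to a nonsingular odometer $(Y,\nu)$ if there is a map $\pi$ as in the definition of a factor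 which is invertible modulo null sets. Consider the conditions: 3. $T$ is not isomorphic to any nonsingular odometer; 4. for each odometer sequence $(\Gamma_n)_{n\ge1}$ and all $0=q_0<q_1<\cdots$ such that the $\boldsymbol q$-telescoping of $\mathcal T$ is compatible with $(\Gamma_n)_{n\ge1}$, there are $n>0$ and $\epsilon_0>0$ such that for all $l>0$, $D_l\subset G/\Gamma_l$ and $M>n$ there is $m>M$ with $$\widetilde\nu_m\Big(\widetilde C_{n+1}\cdots\widetilde C_m\,\triangle\,\{f\in\widetilde F_m\mid f\Gamma_l\in D_l\}\Big)>\epsilon_0 .$$ Then 3 implies 4. If $\mu(X)=\lim_{n\to\infty}\nu_n(F_n)<\infty$, then 3 and 4 are equivalent. -/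

import Mathlib

open MeasureTheory Filter Topology
open scoped ENNReal Pointwise

/-- The ordered product `C n * C (n+1) * ⋯ * C (m-1)` of subsets of `G`
(it is `{1}` if `m ≤ n`). -/
def blockSet {G : Type*} [Group G] (C : ℕ → Set G) (n : ℕ) : ℕ → Set G
  | 0 => 1
  | m + 1 => if n ≤ m then blockSet C n m * C m else 1

/-- The ordered convolution `κ n * κ (n+1) * ⋯ * κ (m-1)` of measures on `G`
(it is the Dirac measure at `1` if `m ≤ n`). -/
noncomputable def blockConv {G : Type*} [Group G] [MeasurableSpace G]
    (κ : ℕ → Measure G) (n : ℕ) : ℕ → Measure G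
  | 0 => Measure.dirac 1
  | m + 1 => if n ≤ m then (blockConv κ n m).mconv (κ m) else Measure.dirac 1

/-- A sequence of quadruples of `(C,F)`-parameters.  The sets `C n` and the measures `κ n` are
indexed from `0`: `C n` and `κ n` here are usually denoted `C_{n+1}` and `κ_{n+1}`. -/
structure CFData (G : Type*) [MeasurableSpace G] where
  /-- `C n` stands for `C_{n+1}` -/
  C : ℕ → Set G
  /-- `F n` stands for `F_n` -/
  F : ℕ → Set G
  /-- `κ n` stands for `κ_{n+1}`, a measure on `G` supported on `C n` -/
  κ : ℕ → Measure G
  /-- `ν n` stands for `ν_n`, a measure on `G` supported on `F n` -/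
  ν : ℕ → Measure G

namespace CFData

variable {G : Type*} [Group G] [MeasurableSpace G]

/-- The standing conditions on the parameters of a nonsingular `(C,F)`-action. -/
structure IsAdmissible (P : CFData G) : Prop where
  finite_C : ∀ n, (P.C n).Finite
  finite_F : ∀ n, (P.F n).Finite
  F_zero : P.F 0 = {1}
  one_mem_F : ∀ n, 1 ∈ P.F n
  one_mem_C : ∀ n, 1 ∈ P.C n
  nontrivial_C : ∀ n, (P.C n).Nontrivial
  mul_subset : ∀ n, P.F n * P.C n ⊆ P.F (n + 1)
  disjoint : ∀ n, ∀ c ∈ P.C n, ∀ c' ∈ P.C n, c ≠ c' →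
    Disjoint (P.F n * {c}) (P.F n * {c'})
  /-- `κ n` is a non-degenerate probability measure on `C n`. -/
  prob_κ : ∀ n, IsProbabilityMeasure (P.κ n)
  κ_compl : ∀ n, P.κ n (P.C n)ᶜ = 0
  κ_pos : ∀ n, ∀ c ∈ P.C n, P.κ n {c} ≠ 0
  /-- the infinite product of the `κ n` has no atoms -/
  nonatomic : Tendsto (fun N => ∏ n ∈ Finset.range N, ⨆ c ∈ P.C n, P.κ n {c}) atTop (𝓝 0)
  /-- `ν n` is a non-degenerate finite measure on `F n`. -/
  finite_ν : ∀ n, IsFiniteMeasure (P.ν n)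
  ν_compl : ∀ n, P.ν n (P.F n)ᶜ = 0
  ν_pos : ∀ n, ∀ f ∈ P.F n, P.ν n {f} ≠ 0
  ν_zero : P.ν 0 = Measure.dirac 1
  ν_succ : ∀ n, ∀ f ∈ P.F n, ∀ c ∈ P.C n, P.ν (n + 1) {f * c} = P.ν n {f} * P.κ n {c}
  /-- the domain `X^G` of the action is conull -/
  conull : ∀ (g : G) (n : ℕ),
    Tendsto (fun m => P.ν m ((P.F n * blockSet P.C n m) ∩ {x | g * x ∈ P.F m})) atTop
      (𝓝 (P.ν n (P.F n)))

/-! ### The space -/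

/-- The sequence whose `m`-th term, for `m ≥ n`, is `f * c n * c (n+1) * ⋯ * c (m-1)`:
the `F m`-coordinate of the point `(f, c n, c (n+1), …)` of `X_n` after it is moved to `X_m`. -/
def path (f : G) (c : ℕ → G) (n : ℕ) : ℕ → G
  | 0 => f
  | m + 1 => if n ≤ m then path f c n m * c m else f

/-- A germ at infinity of sequences in `G` is a point of the `(C,F)`-space if it is the germ of
the sequence of `F m`-coordinates of some point of some `X_n = F n × C n × C (n+1) × ⋯`. -/
def IsPoint (P : CFData G) (x : Germ (atTop : Filter ℕ) G) : Prop :=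
  ∃ (n : ℕ) (f : P.F n) (c : ∀ k, P.C k), x = (path (f : G) (fun k => (c k : G)) n : ℕ → G)

/-- The `(C,F)`-space `X`, the inductive limit of the spaces `X_n = F n × C n × C (n+1) × ⋯`
along the embeddings `(f, c n, c (n+1), …) ↦ (f * c n, c (n+1), …)` of `X_n` into `X_{n+1}`.
Two points `(f, c n, …) ∈ X_n` and `(f', c' n', …) ∈ X_{n'}` are identified in the limit exactly if
their `F m`-coordinates agree for all large `m`; so a point of `X` is recorded as the germ at
infinity of the sequence of its `F m`-coordinates. -/
@[ext]
structure Space (P : CFData G) where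
  /-- the germ at infinity of the sequence of `F m`-coordinates -/
  germ : Germ (atTop : Filter ℕ) G
  isPoint : P.IsPoint germ

/-- The point of `X` given by `(f, c n, c (n+1), …) ∈ X_n`. The entries `c k` with `k < n` are
dummies, which have no influence on the result. -/
def point (P : CFData G) (n : ℕ) (z : P.F n × (∀ k, P.C k)) : P.Space :=
  ⟨(path (z.1 : G) (fun k => (z.2 k : G)) n : ℕ → G), n, z.1, z.2, rfl⟩

/-- The cylinder `[a]_n`: the points `(a, c n, c (n+1), …)` of `X_n` with first coordinate `a`. -/
def cylinder (P : CFData G) (n : ℕ) (a : P.F n) : Set P.Space :=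
  {x | ∃ c : ∀ k, P.C k, x = P.point n (a, c)}

/-- The Borel structure of `X`: the (countably many) cylinders form a base of the topology. -/
instance (P : CFData G) : MeasurableSpace P.Space :=
  MeasurableSpace.generateFrom {A | ∃ (n : ℕ) (a : P.F n), A = P.cylinder n a}

/-! ### The action -/

open Classical in
/-- The transformation `T_g` of the `(C,F)`-space. If `x = (f, c n, c (n+1), …) ∈ X_n` and
`g * f ∈ F n` for some `n`, then `T_g x = (g * f, c n, c (n+1), …)`; on the remaining set
`X \ X^g`, where the action is undefined and which is null, the convention is `T_g x = x`. -/
noncomputable def T (P : CFData G) (g : G) (x : P.Space) : P.Space :=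
  if h : P.IsPoint (x.germ.map (fun s => g * s)) then ⟨x.germ.map (fun s => g * s), h⟩ else x

theorem T_point (P : CFData G) (g : G) (n : ℕ) (f : P.F n) (c : ∀ k, P.C k)
    (h : g * (f : G) ∈ P.F n) : P.T g (P.point n (f, c)) = P.point n (⟨g * f, h⟩, c) := by
  have mul_path : ∀ m, g * path (f : G) (fun k => (c k : G)) n m =
      path (g * (f : G)) (fun k => (c k : G)) n m := by
    intro m
    induction m with
    | zero => rfl
    | succ m ih =>
      simp only [path]
      split_ifs
      · rw [← mul_assoc, ih]
      · rfl
  have key : (P.point n (f, c)).germ.map (fun s => g * s) =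
      (P.point n (⟨g * f, h⟩, c)).germ := by
    simp only [point, Germ.map_coe]
    congr 1
    funext m
    exact mul_path m
  have hp : P.IsPoint ((P.point n (f, c)).germ.map (fun s => g * s)) := by
    rw [key]
    exact (P.point n (⟨g * f, h⟩, c)).isPoint
  unfold T
  rw [dif_pos hp]
  simp only [key]

/-! ### The measure -/

/-- `κ n` as a measure on the set `C n`. -/
noncomputable def κC (P : CFData G) (n : ℕ) : Measure (P.C n) :=
  (P.κ n).comap Subtype.val

/-- `ν n` as a measure on the set `F n`. -/
noncomputable def νF (P : CFData G) (n : ℕ) : Measure (P.F n) :=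
  (P.ν n).comap Subtype.val

theorem isProbabilityMeasure_κC [DiscreteMeasurableSpace G] {P : CFData G}
    (hP : P.IsAdmissible) (n : ℕ) : IsProbabilityMeasure (P.κC n) := by
  have := hP.prob_κ n
  refine (MeasurableEmbedding.subtype_coe
    (MeasurableSet.of_discrete (s := P.C n))).isProbabilityMeasure_comap ?_
  rw [Subtype.range_coe]
  exact hP.κ_compl n

/-- The part of `F n` that the embedding of `X_{n-1}` into `X_n` does not reach:
`F 0` for `n = 0`, and `F n \ F (n-1) * C (n-1)` for `n ≥ 1`. -/
def newF (P : CFData G) : (n : ℕ) → Set (P.F n)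
  | 0 => Set.univ
  | n + 1 => {f | (f : G) ∉ P.F n * P.C n}

/-- The nonsingular `(C,F)`-measure on `X`. The space `X` is the disjoint union of `X_0` and of the
sets `X_n \ X_{n-1}`, `n ≥ 1`, and the measure is equal to the product `ν n ⊗ κ n ⊗ κ (n+1) ⊗ ⋯` on
the `n`-th of these sets. -/
noncomputable def measure [DiscreteMeasurableSpace G] (P : CFData G) (hP : P.IsAdmissible) :
    Measure P.Space :=
  haveI := isProbabilityMeasure_κC hP
  Measure.sum fun n =>
    (((P.νF n).restrict (P.newF n)).prod (Measure.infinitePi fun k => P.κC k)).map (P.point n)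

/-! ### The measure of a cylinder -/

section Cylinder

variable {G : Type*} [Group G]

theorem path_of_le (f : G) (c : ℕ → G) {n m : ℕ} (h : m ≤ n) : path f c n m = f := by
  cases m with
  | zero => rfl
  | succ m => rw [path, if_neg (by omega)]

theorem path_succ (f : G) (c : ℕ → G) {n m : ℕ} (h : n ≤ m) :
    path f c n (m + 1) = path f c n m * c m := by
  rw [path, if_pos h]

theorem path_path (f : G) (c : ℕ → G) {n j m : ℕ} (h : n ≤ j) (h' : j ≤ m) :
    path (path f c n j) c j m = path f c n m := by
  induction m, h' using Nat.le_induction with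
  | base => exact path_of_le _ _ le_rfl
  | succ m hm ih => rw [path_succ _ _ hm, ih, path_succ _ _ (h.trans hm)]

theorem path_congr (f : G) {c d : ℕ → G} {n m : ℕ} (h : ∀ k, n ≤ k → k < m → c k = d k) :
    path f c n m = path f d n m := by
  induction m with
  | zero => rfl
  | succ m ih =>
    simp only [path]
    split_ifs with hn
    · rw [ih fun k h1 h2 => h k h1 (by omega), h m hn (by omega)]
    · rfl

variable [MeasurableSpace G] {P : CFData G}

theorem path_mem (hP : P.IsAdmissible) {n m : ℕ} (h : n ≤ m) (f : P.F n) (c : ∀ k, P.C k) :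
    path (f : G) (fun k => (c k : G)) n m ∈ P.F m := by
  induction m, h using Nat.le_induction with
  | base => rw [path_of_le _ _ le_rfl]; exact f.2
  | succ m hm ih =>
    rw [path_succ _ _ hm]
    exact hP.mul_subset m (Set.mul_mem_mul ih (c m).2)

theorem mul_unique (hP : P.IsAdmissible) {n : ℕ} {a b c d : G} (ha : a ∈ P.F n) (hb : b ∈ P.F n)
    (hc : c ∈ P.C n) (hd : d ∈ P.C n) (h : a * c = b * d) : a = b ∧ c = d := by
  have hcd : c = d := by
    by_contra hne
    refine Set.disjoint_left.1 (hP.disjoint n c hc d hd hne)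
      (Set.mul_mem_mul ha (Set.mem_singleton c)) ?_
    rw [h]
    exact Set.mul_mem_mul hb (Set.mem_singleton d)
  subst hcd
  exact ⟨mul_right_cancel h, rfl⟩

theorem path_unique (hP : P.IsAdmissible) {n m : ℕ} (h : n ≤ m) (f f' : P.F n)
    (c c' : ∀ k, P.C k)
    (e : path (f : G) (fun k => (c k : G)) n m = path (f' : G) (fun k => (c' k : G)) n m) :
    f = f' ∧ ∀ k, n ≤ k → k < m → c k = c' k := by
  induction m, h using Nat.le_induction with
  | base =>
    rw [path_of_le _ _ le_rfl, path_of_le _ _ le_rfl] at e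
    exact ⟨Subtype.ext e, fun k h1 h2 => by omega⟩
  | succ m hm ih =>
    rw [path_succ _ _ hm, path_succ _ _ hm] at e
    obtain ⟨h1, h2⟩ := mul_unique hP (path_mem hP hm f c) (path_mem hP hm f' c') (c m).2 (c' m).2 e
    obtain ⟨h3, h4⟩ := ih h1
    refine ⟨h3, fun k hk hk' => ?_⟩
    rcases Nat.lt_succ_iff_lt_or_eq.1 hk' with hlt | rfl
    · exact h4 k hk hlt
    · exact Subtype.ext h2

theorem point_eq_iff (n j : ℕ) (z : P.F n × (∀ k, P.C k)) (w : P.F j × (∀ k, P.C k)) :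
    P.point n z = P.point j w ↔ ∀ᶠ m in atTop,
      path (z.1 : G) (fun k => (z.2 k : G)) n m = path (w.1 : G) (fun k => (w.2 k : G)) j m := by
  rw [Space.ext_iff]
  exact Germ.coe_eq

theorem point_mem_cylinder_of_le (hP : P.IsAdmissible) {j n : ℕ} (h : j ≤ n) (a : P.F n)
    (z : P.F j × (∀ k, P.C k)) :
    P.point j z ∈ P.cylinder n a ↔ path (z.1 : G) (fun k => (z.2 k : G)) j n = a := by
  constructor
  · rintro ⟨c, hc⟩
    rw [point_eq_iff] at hc
    obtain ⟨m, hm, hnm⟩ := (hc.and (eventually_ge_atTop n)).exists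
    rw [← path_path _ _ h hnm] at hm
    exact congrArg Subtype.val
      (path_unique hP hnm ⟨_, path_mem hP h z.1 z.2⟩ a z.2 c hm).1
  · intro e
    refine ⟨z.2, ?_⟩
    rw [point_eq_iff]
    filter_upwards [eventually_ge_atTop n] with m hm
    rw [← path_path _ _ h hm, e]

theorem point_mem_cylinder_of_ge (hP : P.IsAdmissible) {j n : ℕ} (h : n ≤ j) (a : P.F n)
    (z : P.F j × (∀ k, P.C k)) :
    P.point j z ∈ P.cylinder n a ↔
      ∃ c : ∀ k, P.C k, path (a : G) (fun k => (c k : G)) n j = z.1 := by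
  constructor
  · rintro ⟨c, hc⟩
    refine ⟨c, ?_⟩
    rw [eq_comm, point_eq_iff] at hc
    obtain ⟨m, hm, hjm⟩ := (hc.and (eventually_ge_atTop j)).exists
    rw [← path_path _ _ h hjm] at hm
    exact congrArg Subtype.val
      (path_unique hP hjm ⟨_, path_mem hP h a c⟩ z.1 c z.2 hm).1
  · rintro ⟨c, hc⟩
    refine ⟨fun k => if k < j then c k else z.2 k, ?_⟩
    rw [eq_comm, point_eq_iff]
    filter_upwards [eventually_ge_atTop j] with m hm
    rw [← path_path _ _ h hm]
    have h1 : path (a : G) (fun k => ((if k < j then c k else z.2 k : P.C k) : G)) n j = z.1 := by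
      rw [← hc]
      exact path_congr _ fun k _ hk => by rw [if_pos hk]
    rw [h1]
    exact path_congr _ fun k hk _ => by rw [if_neg (by omega)]

theorem path_not_new (hP : P.IsAdmissible) {n j : ℕ} (h : n < j) (a : P.F n) (c : ∀ k, P.C k)
    (f : P.F j) (hf : f ∈ P.newF j) : path (a : G) (fun k => (c k : G)) n j ≠ f := by
  intro e
  obtain ⟨j, rfl⟩ : ∃ i, j = i + 1 := ⟨j - 1, by omega⟩
  refine hf ?_
  rw [← e, path_succ _ _ (by omega)]
  exact Set.mul_mem_mul (path_mem hP (by omega) a c) (c j).2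

theorem exists_new (hP : P.IsAdmissible) (n : ℕ) (a : P.F n) :
    ∃ j, j ≤ n ∧ ∃ f ∈ P.newF j, ∃ d : ∀ k, P.C k,
      path (f : G) (fun k => (d k : G)) j n = a := by
  induction n with
  | zero => exact ⟨0, le_rfl, a, trivial, fun k => ⟨1, hP.one_mem_C k⟩, rfl⟩
  | succ n ih =>
    by_cases ha : a ∈ P.newF (n + 1)
    · exact ⟨n + 1, le_rfl, a, ha, fun k => ⟨1, hP.one_mem_C k⟩, path_of_le _ _ le_rfl⟩
    · obtain ⟨b, hb, c0, hc0, e⟩ : (a : G) ∈ P.F n * P.C n := not_not.1 ha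
      obtain ⟨j, hj, f, hf, d, hd⟩ := ih ⟨b, hb⟩
      refine ⟨j, by omega, f, hf, fun k => if hk : k = n then ⟨c0, hk ▸ hc0⟩ else d k, ?_⟩
      rw [path_succ _ _ hj, ← e]
      dsimp only
      rw [dif_pos rfl]
      congr 1
      rw [← show _ = b from hd]
      exact path_congr _ fun k _ hk => by rw [dif_neg (by omega)]

theorem ν_path (hP : P.IsAdmissible) {j n : ℕ} (h : j ≤ n) (f : P.F j) (d : ∀ k, P.C k) :
    P.ν n {path (f : G) (fun k => (d k : G)) j n} =
      P.ν j {(f : G)} * ∏ k ∈ Finset.Ico j n, P.κ k {(d k : G)} := by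
  induction n, h using Nat.le_induction with
  | base => simp [path_of_le]
  | succ n hn ih =>
    rw [path_succ _ _ hn, hP.ν_succ n _ (path_mem hP hn f d) _ (d n).2, ih,
      Finset.prod_Ico_succ_top hn, mul_assoc]

variable [DiscreteMeasurableSpace G]

theorem measurable_point [Countable G] (hP : P.IsAdmissible) (j : ℕ) :
    Measurable (P.point j) := by
  refine measurable_generateFrom ?_
  rintro _ ⟨n, a, rfl⟩
  rcases le_total j n with h | h
  · have : Measurable fun z : P.F j × (∀ k, P.C k) =>
        path (z.1 : G) (fun k => (z.2 k : G)) j n := by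
      clear a
      induction n, h using Nat.le_induction with
      | base =>
        simp only [path_of_le _ _ (le_refl j)]
        fun_prop
      | succ n hn ih =>
        simp only [path_succ _ _ hn]
        exact (Measurable.of_discrete (f := fun p : G × G => p.1 * p.2)).comp
          (ih.prodMk (by fun_prop))
    convert this (MeasurableSet.of_discrete (s := {(a : G)})) using 1
    ext z
    exact point_mem_cylinder_of_le hP h a z
  · have : P.point j ⁻¹' P.cylinder n a = Prod.fst ⁻¹'
        {f : P.F j | ∃ c : ∀ k, P.C k, path (a : G) (fun k => (c k : G)) n j = f} := by
      ext z
      exact point_mem_cylinder_of_ge hP h a z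
    rw [this]
    exact measurable_fst (MeasurableSet.of_discrete)

/-- The measure of `X` takes the value `ν n {a}` on the cylinder `[a]_n`. -/
theorem measure_cylinder [Countable G] (hP : P.IsAdmissible) (n : ℕ) (a : P.F n) :
    P.measure hP (P.cylinder n a) = P.ν n {(a : G)} := by
  have hκ := isProbabilityMeasure_κC hP
  have hν := hP.finite_ν
  have hνF : ∀ j, IsFiniteMeasure (P.νF j) := fun j =>
    ⟨by
      rw [νF, comap_subtype_coe_apply (MeasurableSet.of_discrete)]
      exact measure_lt_top _ _⟩
  have hmeas : MeasurableSet (P.cylinder n a) := MeasurableSpace.measurableSet_generateFrom ⟨n, a, rfl⟩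
  obtain ⟨j, hj, f, hf, d, hd⟩ := exists_new hP n a
  rw [measure, Measure.sum_apply _ hmeas, tsum_eq_single j]
  · rw [Measure.map_apply (measurable_point hP j) hmeas]
    have hset : P.point j ⁻¹' P.cylinder n a =
        {f} ×ˢ Set.pi (Finset.Ico j n : Set ℕ) (fun k => {d k}) := by
      ext z
      rw [Set.mem_preimage, point_mem_cylinder_of_le hP hj]
      simp only [Set.mem_prod, Set.mem_singleton_iff, Set.mem_pi, Finset.coe_Ico, Set.mem_Ico]
      constructor
      · intro e
        obtain ⟨h1, h2⟩ := path_unique hP hj z.1 f z.2 d (e.trans hd.symm)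
        exact ⟨h1, fun k hk => h2 k hk.1 hk.2⟩
      · rintro ⟨h1, h2⟩
        rw [← hd, h1]
        exact path_congr _ fun k h3 h4 => by rw [h2 k ⟨h3, h4⟩]
    rw [hset, Measure.prod_prod, Measure.infinitePi_pi _ (fun k _ => MeasurableSet.of_discrete),
      Measure.restrict_apply (MeasurableSet.of_discrete),
      Set.inter_eq_left.2 (Set.singleton_subset_iff.2 hf), ← hd, ν_path hP hj, νF,
      comap_subtype_coe_apply (MeasurableSet.of_discrete)]
    simp only [κC, comap_subtype_coe_apply (MeasurableSet.of_discrete), Set.image_singleton]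
  · intro i hi
    rw [Measure.map_apply (measurable_point hP i) hmeas]
    have hsub : P.point i ⁻¹' P.cylinder n a ⊆ (P.newF i)ᶜ ×ˢ Set.univ := by
      intro z hz
      refine ⟨fun hz1 => ?_, trivial⟩
      rcases lt_or_ge n i with h | h
      · obtain ⟨c, hc⟩ := (point_mem_cylinder_of_ge hP h.le a z).1 hz
        exact path_not_new hP h a c z.1 hz1 hc
      · have e := (point_mem_cylinder_of_le hP h a z).1 hz
        rcases lt_or_gt_of_ne hi with hlt | hlt
        · rw [← path_path _ _ hlt.le hj] at e
          have := (path_unique hP hj ⟨_, path_mem hP hlt.le z.1 z.2⟩ f z.2 d (e.trans hd.symm)).1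
          exact path_not_new hP hlt z.1 z.2 f hf (congrArg Subtype.val this)
        · rw [← path_path _ _ hlt.le h] at hd
          have := (path_unique hP h ⟨_, path_mem hP hlt.le f d⟩ z.1 d z.2 (hd.trans e.symm)).1
          exact path_not_new hP hlt f d z.1 hz1 (congrArg Subtype.val this)
    refine measure_mono_null hsub ?_
    rw [Measure.prod_prod, Measure.restrict_apply (MeasurableSet.of_discrete)]
    simp

end Cylinder

/-! ### Telescopings -/

/-- The `l`-telescoping of a sequence of `(C,F)`-parameters. -/
noncomputable def telescope (P : CFData G) (l : ℕ → ℕ) : CFData G where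
  C n := blockSet P.C (l n) (l (n + 1))
  F n := P.F (l n)
  κ n := blockConv P.κ (l n) (l (n + 1))
  ν n := P.ν (l n)

/-- The parameters are compatible with the sequence `(Γ n)` of subgroups, that is, with the base
point of the projective limit of the spaces `G ⧸ Γ n`. -/
def IsCompatible (P : CFData G) (Γ : ℕ → Subgroup G) : Prop :=
  ∑' n, P.κ n {c | c ∈ P.C n ∧ c ∉ Γ n} < ∞

end CFData

/-! ### Odometers -/

/-- A strictly decreasing sequence of subgroups of finite index such that the intersection of all
conjugates of all of them is trivial. -/
structure IsOdometerSequence {G : Type*} [Group G] (Γ : ℕ → Subgroup G) : Prop where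
  strictAnti : StrictAnti Γ
  finiteIndex : ∀ n, (Γ n).FiniteIndex
  iInter_conj : ⋂ (n : ℕ) (g : G), {x : G | ∃ γ ∈ Γ n, x = g * γ * g⁻¹} = {1}

/-- The space of the odometer: the projective limit of the homogeneous spaces `G ⧸ Γ n`, i.e. the
sequences `(g_n Γ_n)` of cosets with `g_{n+1} Γ_{n+1} ⊆ g_n Γ_n`. -/
@[ext]
structure OdometerSpace {G : Type*} [Group G] (Γ : ℕ → Subgroup G) where
  /-- the coset `coord n = g_n Γ_n` -/
  coord : ∀ n, G ⧸ Γ n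
  coherent : ∀ (n : ℕ) (g : G),
    coord (n + 1) = (g : G ⧸ Γ (n + 1)) → coord n = (g : G ⧸ Γ n)

namespace OdometerSpace

variable {G : Type*} [Group G]

/-- The Borel structure of the odometer, induced by the product of the discrete spaces `G ⧸ Γ n`. -/
instance [MeasurableSpace G] (Γ : ℕ → Subgroup G) : MeasurableSpace (OdometerSpace Γ) :=
  MeasurableSpace.comap coord MeasurableSpace.pi

/-- The action of `G` on the odometer by left translations of all coordinates. -/
instance (Γ : ℕ → Subgroup G) : MulAction G (OdometerSpace Γ) where
  smul g y := ⟨fun n => g • y.coord n, fun n h hy => by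
    have h1 : y.coord (n + 1) = ((g⁻¹ * h : G) : G ⧸ Γ (n + 1)) := by
      rw [eq_comm, ← inv_smul_eq_iff] at hy
      exact hy.symm
    have h2 := y.coherent n _ h1
    change g • y.coord n = _
    rw [h2]
    change ((g * (g⁻¹ * h) : G) : G ⧸ Γ n) = _
    rw [mul_inv_cancel_left]⟩
  one_smul y := OdometerSpace.ext (funext fun n => one_smul G (y.coord n))
  mul_smul g h y := OdometerSpace.ext (funext fun n => mul_smul g h (y.coord n))

end OdometerSpace

/-- `ν` makes the topological odometer associated with `Γ` a nonsingular odometer: `ν` is a nonzero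
`σ`-finite Borel measure that is quasi-invariant and ergodic under the action of `G`. -/
structure IsNonsingularOdometer {G : Type*} [Group G] [MeasurableSpace G] (Γ : ℕ → Subgroup G)
    (ν : Measure (OdometerSpace Γ)) : Prop where
  sigmaFinite : SigmaFinite ν
  ne_zero : ν ≠ 0
  quasiInvariant : ∀ g : G,
    Measure.QuasiMeasurePreserving (fun y : OdometerSpace Γ => g • y) ν ν
  ergodic : ∀ A : Set (OdometerSpace Γ), MeasurableSet A →
    (∀ g : G, (fun y : OdometerSpace Γ => g • y) ⁻¹' A =ᵐ[ν] A) → ν A = 0 ∨ ν Aᶜ = 0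

/-- The odometer `(OdometerSpace Γ, ν)` is a factor of the nonsingular `(C,F)`-action: it is the
image of the action under a nonsingular `G`-equivariant map, defined modulo null sets. -/
def CFData.HasFactor {G : Type*} [Group G] [MeasurableSpace G] [DiscreteMeasurableSpace G]
    (P : CFData G) (hP : P.IsAdmissible) (Γ : ℕ → Subgroup G)
    (ν : Measure (OdometerSpace Γ)) : Prop :=
  ∃ π : P.Space → OdometerSpace Γ, Measurable π ∧
    (∀ g : G, ∀ᵐ x ∂(P.measure hP), π (P.T g x) = g • π x) ∧
    (P.measure hP).map π ≪ ν ∧ ν ≪ (P.measure hP).map π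

/-- The nonsingular `(C,F)`-action is isomorphic to the odometer `(OdometerSpace Γ, ν)`: there is a
nonsingular `G`-equivariant map between them which is invertible modulo null sets. -/
def CFData.IsIsomorphicTo {G : Type*} [Group G] [MeasurableSpace G] [DiscreteMeasurableSpace G]
    (P : CFData G) (hP : P.IsAdmissible) (Γ : ℕ → Subgroup G)
    (ν : Measure (OdometerSpace Γ)) : Prop :=
  ∃ (π : P.Space → OdometerSpace Γ) (σ : OdometerSpace Γ → P.Space),
    Measurable π ∧ Measurable σ ∧
    (∀ᵐ x ∂(P.measure hP), σ (π x) = x) ∧ (∀ᵐ y ∂ν, π (σ y) = y) ∧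
    (∀ g : G, ∀ᵐ x ∂(P.measure hP), π (P.T g x) = g • π x) ∧
    (P.measure hP).map π ≪ ν ∧ ν ≪ (P.measure hP).map π

/-- Failure of the approximation condition (at the base point of the odometer): for some `n > 0`,
the sets `C_{n+1} ⋯ C_m`, in the usual indexing, cannot be approximated, with arbitrary precision
and for all large `m`, by sets of those `f ∈ F m` whose coset `f Γ_l` lies in a given set `D` of
cosets of some `Γ_l`. -/
def CFData.ApproximationFails {G : Type*} [Group G] [MeasurableSpace G]
    (P : CFData G) (Γ : ℕ → Subgroup G) : Prop :=
  ∃ n : ℕ, 0 < n ∧ ∃ ε : ℝ≥0∞, 0 < ε ∧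
    ∀ (l : ℕ) (D : Set (G ⧸ Γ l)) (M : ℕ), n < M → ∃ m, M < m ∧
      ε < P.ν m (symmDiff (blockSet P.C n m) {f | f ∈ P.F m ∧ (f : G ⧸ Γ l) ∈ D})

/-!
Write `x ∈ X` as an eventually multiplicative path `(f_n)`, where `f_n ∈ F n` is its coordinate in
`X_n` and the increments `f_n⁻¹ f_{n+1}` lie in `C n`.

If a telescoping is compatible with `Γ`, then by the Borel–Cantelli lemma almost every path has its
`k`-th telescoped increment in `Γ k` for all large `k`. Hence its cosets `f_n Γ_l` stabilize along
the telescoping, and their limits form an equivariant map from `X` to the odometer of `Γ`. The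
image measure is quasi-invariant and ergodic because `μ` is.

Conversely, let `π` be an equivariant map to an odometer. On the box `{f_n = 1}` every coordinate of
`π` is nearly constant for suitable large `n`: otherwise, since translations carry this box to the
other boxes of `X_n` and rescale `μ`, no union of boxes could approximate a fibre of that
coordinate. The nearly constant values form a point `y` of the odometer. As `π` intertwines the
increment `c` with translation by `c`, most increments fix the coordinates of `y`, so a fast
telescoping is compatible with the stabilizers of these coordinates, which are conjugates of the
groups `Γ n`.

If `⋂ Γ n` is finite, the fibre of the limit map over a point meets every orbit in boundedly many
points, and is null because the masses of the boxes tend to `0`; so the image measure is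
non-atomic. Finally, an equivariant map is invertible modulo null sets iff it generates the Borel
σ-algebra modulo null sets, and by equivariance it is enough to approximate the boxes `{f_n = 1}`
by preimages of sets of cosets.
-/

/-! ### Finite products of the sets `C n` and of the measures `κ n` -/

section BlockSet

variable {G : Type*} [Group G]

theorem blockSet_self (C : ℕ → Set G) (n : ℕ) : blockSet C n n = 1 := by
  cases n with
  | zero => rfl
  | succ n => rw [blockSet, if_neg (by omega)]

theorem blockSet_succ (C : ℕ → Set G) {n m : ℕ} (h : n ≤ m) :
    blockSet C n (m + 1) = blockSet C n m * C m := by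
  rw [blockSet, if_pos h]

theorem blockSet_mul_blockSet (C : ℕ → Set G) {n j m : ℕ} (h : n ≤ j) (h' : j ≤ m) :
    blockSet C n j * blockSet C j m = blockSet C n m := by
  induction m, h' using Nat.le_induction with
  | base => rw [blockSet_self, mul_one]
  | succ m hm ih => rw [blockSet_succ _ hm, blockSet_succ _ (h.trans hm), ← mul_assoc, ih]

theorem blockSet_comp (C : ℕ → Set G) {q : ℕ → ℕ} (hq : Monotone q) {n m : ℕ} (h : n ≤ m) :
    blockSet (fun k => blockSet C (q k) (q (k + 1))) n m = blockSet C (q n) (q m) := by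
  induction m, h using Nat.le_induction with
  | base => rw [blockSet_self, blockSet_self]
  | succ m hm ih =>
    rw [blockSet_succ _ hm, ih, blockSet_mul_blockSet _ (hq hm) (hq (Nat.le_succ m))]

end BlockSet

section Convolution

open scoped MeasureTheory

variable {M : Type*} [Monoid M] [MeasurableSpace M] [DiscreteMeasurableSpace M] [MeasurableMul₂ M]

theorem ae_mem_prod_of_compl_eq_zero {α β : Type*} [MeasurableSpace α] [MeasurableSpace β]
    {μ : Measure α} {ν : Measure β} [SFinite ν] {A : Set α} {B : Set β}
    (hA : μ Aᶜ = 0) (hB : ν Bᶜ = 0) : ∀ᵐ x ∂μ.prod ν, x ∈ A ×ˢ B := by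
  rw [ae_iff]
  change μ.prod ν (A ×ˢ B)ᶜ = 0
  rw [Set.compl_prod_eq_union, measure_union_null_iff, Measure.prod_prod, Measure.prod_prod,
    hA, hB, zero_mul, mul_zero]
  exact ⟨rfl, rfl⟩

theorem mconv_compl_mul_eq_zero {μ ν : Measure M} [SFinite ν] {A B : Set M}
    (hA : μ Aᶜ = 0) (hB : ν Bᶜ = 0) : (μ ∗ₘ ν) (A * B)ᶜ = 0 := by
  rw [Measure.mconv, Measure.map_apply measurable_mul MeasurableSet.of_discrete,
    measure_eq_zero_iff_ae_notMem]
  filter_upwards [ae_mem_prod_of_compl_eq_zero hA hB] with x hx hmem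
  exact hmem (Set.mul_mem_mul hx.1 hx.2)

theorem mconv_singleton_mul {μ ν : Measure M} [SFinite ν] {A B : Set M} (hA : μ Aᶜ = 0)
    (hB : ν Bᶜ = 0) (hinj : (A ×ˢ B).InjOn fun x : M × M => x.1 * x.2) {a b : M} (ha : a ∈ A)
    (hb : b ∈ B) : (μ ∗ₘ ν) {a * b} = μ {a} * ν {b} := by
  rw [Measure.mconv, Measure.map_apply measurable_mul MeasurableSet.of_discrete,
    ← Measure.prod_prod, Set.singleton_prod_singleton]
  refine measure_congr ?_
  filter_upwards [ae_mem_prod_of_compl_eq_zero hA hB] with x hx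
  exact propext (hinj.eq_iff hx (Set.mk_mem_prod ha hb))

end Convolution

section BlockConv

variable {G : Type*} [Group G] [MeasurableSpace G]

theorem blockConv_self (κ : ℕ → Measure G) (n : ℕ) : blockConv κ n n = Measure.dirac 1 := by
  cases n with
  | zero => rfl
  | succ n => rw [blockConv, if_neg (by omega)]

theorem blockConv_succ (κ : ℕ → Measure G) {n m : ℕ} (h : n ≤ m) :
    blockConv κ n (m + 1) = (blockConv κ n m).mconv (κ m) := by
  rw [blockConv, if_pos h]

variable [MeasurableMul₂ G]

instance isProbabilityMeasure_blockConv (κ : ℕ → Measure G) [∀ k, IsProbabilityMeasure (κ k)]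
    (n m : ℕ) : IsProbabilityMeasure (blockConv κ n m) := by
  induction m with
  | zero => exact Measure.dirac.isProbabilityMeasure
  | succ m ih =>
    rw [blockConv]
    split_ifs <;> infer_instance

theorem blockConv_compl_blockSet [DiscreteMeasurableSpace G] {κ : ℕ → Measure G}
    [∀ k, SFinite (κ k)] {C : ℕ → Set G} (h : ∀ k, κ k (C k)ᶜ = 0) (n m : ℕ) :
    blockConv κ n m (blockSet C n m)ᶜ = 0 := by
  induction m with
  | zero => simp [blockConv, blockSet]
  | succ m ih =>
    rw [blockConv, blockSet]
    split_ifs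
    · exact mconv_compl_mul_eq_zero ih (h m)
    · simp

end BlockConv

theorem measure_eq_tsum_singleton {α : Type*} [MeasurableSpace α] [MeasurableSingletonClass α]
    [Countable α] (μ : Measure α) (S : Set α) : μ S = ∑' a : S, μ {(a : α)} :=
  (tsum_measure_preimage_singleton (f := id) S.to_countable fun a _ =>
    measurableSet_singleton a).symm

namespace CFData.IsAdmissible

variable {G : Type*} [Group G] [MeasurableSpace G] {P : CFData G}

theorem one_mem_blockSet (hP : P.IsAdmissible) {n m : ℕ} (h : n ≤ m) :
    1 ∈ blockSet P.C n m := by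
  induction m, h using Nat.le_induction with
  | base => rw [blockSet_self]; exact Set.one_mem_one
  | succ m hm ih =>
    rw [blockSet_succ _ hm, ← one_mul (1 : G)]
    exact Set.mul_mem_mul ih (hP.one_mem_C m)

theorem mul_mem_F (hP : P.IsAdmissible) {n m : ℕ} (h : n ≤ m) {a b : G}
    (ha : a ∈ P.F n) (hb : b ∈ blockSet P.C n m) : a * b ∈ P.F m := by
  induction m, h using Nat.le_induction generalizing b with
  | base =>
    rw [blockSet_self] at hb
    rwa [Set.mem_one.1 hb, mul_one]
  | succ m hm ih =>
    rw [blockSet_succ _ hm] at hb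
    obtain ⟨b, hb, c, hc, rfl⟩ := hb
    rw [← mul_assoc]
    exact hP.mul_subset m (Set.mul_mem_mul (ih hb) hc)

theorem blockSet_subset (hP : P.IsAdmissible) {n m : ℕ} (h : n ≤ m) :
    blockSet P.C n m ⊆ P.F m := fun b hb => by
  simpa using hP.mul_mem_F h (hP.one_mem_F n) hb

theorem ν_eq_zero (hP : P.IsAdmissible) {n : ℕ} {a : G} (h : a ∉ P.F n) : P.ν n {a} = 0 :=
  measure_mono_null (Set.singleton_subset_iff.2 h) (hP.ν_compl n)

theorem ν_ne_top (hP : P.IsAdmissible) (n : ℕ) (s : Set G) : P.ν n s ≠ ∞ :=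
  have := hP.finite_ν n
  measure_ne_top _ _

theorem ν_one_ne_zero (hP : P.IsAdmissible) (n : ℕ) : P.ν n {1} ≠ 0 :=
  hP.ν_pos n 1 (hP.one_mem_F n)

theorem tendsto_prod_Ico (hP : P.IsAdmissible) (n : ℕ) :
    Tendsto (fun m => ∏ k ∈ Finset.Ico n m, ⨆ c ∈ P.C k, P.κ k {c}) atTop (𝓝 0) := by
  set r : ℕ → ℝ≥0∞ := fun k => ⨆ c ∈ P.C k, P.κ k {c}
  have r_ne_zero (k) : r k ≠ 0 := fun h => hP.κ_pos k 1 (hP.one_mem_C k) (le_antisymm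
    (h ▸ le_iSup₂ (f := fun c (_ : c ∈ P.C k) => P.κ k {c}) 1 (hP.one_mem_C k)) zero_le)
  have r_ne_top (k) : r k ≠ ∞ := ne_top_of_le_ne_top ENNReal.one_ne_top
    (iSup₂_le fun c _ => have := hP.prob_κ k; prob_le_one)
  have prod_ne_zero : ∏ k ∈ Finset.range n, r k ≠ 0 :=
    Finset.prod_ne_zero_iff.2 fun k _ => r_ne_zero k
  have prod_ne_top : ∏ k ∈ Finset.range n, r k ≠ ∞ := ENNReal.prod_ne_top fun k _ => r_ne_top k
  have hlim := ENNReal.Tendsto.const_mul (a := (∏ k ∈ Finset.range n, r k)⁻¹) hP.nonatomic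
    (Or.inr (ENNReal.inv_ne_top.2 prod_ne_zero))
  rw [mul_zero] at hlim
  refine hlim.congr' ?_
  filter_upwards [eventually_ge_atTop n] with m hm
  rw [← Finset.prod_range_mul_prod_Ico _ hm, ← mul_assoc,
    ENNReal.inv_mul_cancel prod_ne_zero prod_ne_top, one_mul]

variable [DiscreteMeasurableSpace G] [Countable G]

theorem blockConv_compl (hP : P.IsAdmissible) (n m : ℕ) :
    blockConv P.κ n m (blockSet P.C n m)ᶜ = 0 :=
  have := hP.prob_κ
  blockConv_compl_blockSet hP.κ_compl n m

theorem blockConv_succ_singleton (hP : P.IsAdmissible) {n m : ℕ} (h : n ≤ m) {b c : G}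
    (hb : b ∈ blockSet P.C n m) (hc : c ∈ P.C m) :
    blockConv P.κ n (m + 1) {b * c} = blockConv P.κ n m {b} * P.κ m {c} := by
  have := hP.prob_κ m
  rw [blockConv_succ _ h]
  refine mconv_singleton_mul (hP.blockConv_compl n m) (hP.κ_compl m) ?_ hb hc
  intro x hx y hy hxy
  obtain ⟨h₁, h₂⟩ :=
    mul_unique hP (hP.blockSet_subset h hx.1) (hP.blockSet_subset h hy.1) hx.2 hy.2 hxy
  exact Prod.ext h₁ h₂

theorem ν_singleton_mul (hP : P.IsAdmissible) {n m : ℕ} (h : n ≤ m) {a b : G}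
    (ha : a ∈ P.F n) (hb : b ∈ blockSet P.C n m) :
    P.ν m {a * b} = P.ν n {a} * blockConv P.κ n m {b} := by
  induction m, h using Nat.le_induction generalizing b with
  | base =>
    rw [blockSet_self, Set.mem_one] at hb
    simp [hb, blockConv_self]
  | succ m hm ih =>
    rw [blockSet_succ _ hm] at hb
    obtain ⟨b, hb, c, hc, rfl⟩ := hb
    dsimp only
    rw [← mul_assoc, hP.ν_succ m _ (hP.mul_mem_F hm ha hb) _ hc, ih hb,
      hP.blockConv_succ_singleton hm hb hc, mul_assoc]

theorem ν_eq_mul_blockConv (hP : P.IsAdmissible) {n m : ℕ} (h : n ≤ m) {B : Set G}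
    (hB : B ⊆ blockSet P.C n m) : P.ν m B = P.ν n {1} * blockConv P.κ n m B := by
  rw [measure_eq_tsum_singleton (P.ν m), measure_eq_tsum_singleton (blockConv P.κ n m),
    ← ENNReal.tsum_mul_left]
  exact tsum_congr fun b => by
    rw [← hP.ν_singleton_mul h (hP.one_mem_F n) (hB b.2), one_mul]

end CFData.IsAdmissible

/-! ### Coordinates on the `(C,F)`-space -/

theorem isCofinal_Ici {α : Type*} [Preorder α] [IsDirectedOrder α] (a : α) :
    IsCofinal (Set.Ici a) :=
  fun b => (exists_ge_ge a b).imp fun _ h => h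

namespace CFData

variable {G : Type*} [Group G] [MeasurableSpace G] {P : CFData G}

/-- The cylinder `[a]_n`, for an arbitrary element `a` of the group; it is empty if `a ∉ F n`. -/
def box (P : CFData G) (n : ℕ) (a : G) : Set P.Space :=
  {x | ∃ h : a ∈ P.F n, x ∈ P.cylinder n ⟨a, h⟩}

theorem box_eq_cylinder {n : ℕ} (a : P.F n) : P.box n a = P.cylinder n a := by
  ext x
  exact ⟨fun ⟨_, h⟩ => h, fun h => ⟨a.2, h⟩⟩

theorem box_eq_empty {n : ℕ} {a : G} (h : a ∉ P.F n) : P.box n a = ∅ :=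
  Set.eq_empty_of_forall_notMem fun _ hx => h hx.1

theorem mem_F_of_mem_box {n : ℕ} {a : G} {x : P.Space} (h : x ∈ P.box n a) : a ∈ P.F n := h.1

theorem exists_eq_point (x : P.Space) : ∃ n z, x = P.point n z := by
  obtain ⟨g, n, f, c, rfl⟩ := x
  exact ⟨n, (f, c), rfl⟩

theorem point_mem_box_iff (hP : P.IsAdmissible) {j n : ℕ} (h : j ≤ n) (a : G)
    (z : P.F j × (∀ k, P.C k)) :
    P.point j z ∈ P.box n a ↔ path (z.1 : G) (fun k => (z.2 k : G)) j n = a := by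
  constructor
  · rintro ⟨_, hmem⟩
    exact (point_mem_cylinder_of_le hP h _ _).1 hmem
  · intro e
    have ha : a ∈ P.F n := e ▸ path_mem hP h z.1 z.2
    exact ⟨ha, (point_mem_cylinder_of_le hP h ⟨a, ha⟩ _).2 e⟩

theorem eq_of_mem_box (hP : P.IsAdmissible) {n : ℕ} {a b : G} {x : P.Space}
    (ha : x ∈ P.box n a) (hb : x ∈ P.box n b) : a = b := by
  obtain ⟨h, c, rfl⟩ := ha
  rwa [point_mem_box_iff hP le_rfl, path_of_le _ _ le_rfl] at hb

theorem exists_mem_box (hP : P.IsAdmissible) (x : P.Space) : ∃ n a, x ∈ P.box n a := by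
  obtain ⟨n, z, rfl⟩ := exists_eq_point x
  exact ⟨n, _, (point_mem_box_iff hP le_rfl _ _).2 rfl⟩

theorem exists_mem_box_succ (hP : P.IsAdmissible) {n : ℕ} {a : G} {x : P.Space}
    (hx : x ∈ P.box n a) : ∃ c ∈ P.C n, x ∈ P.box (n + 1) (a * c) := by
  obtain ⟨h, c, rfl⟩ := hx
  refine ⟨c n, (c n).2, ?_⟩
  rw [point_mem_box_iff hP (Nat.le_succ n), path_succ _ _ le_rfl, path_of_le _ _ le_rfl]

theorem box_succ_subset (hP : P.IsAdmissible) {n : ℕ} {a c : G} (ha : a ∈ P.F n)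
    (hc : c ∈ P.C n) : P.box (n + 1) (a * c) ⊆ P.box n a := by
  classical
  rintro x ⟨h, d, rfl⟩
  refine ⟨ha, (point_mem_cylinder_of_ge hP (Nat.le_succ n) _ _).2
    ⟨fun k => if hk : k = n then ⟨c, hk ▸ hc⟩ else d k, ?_⟩⟩
  rw [path_succ _ _ le_rfl, path_of_le _ _ le_rfl]
  simp

theorem exists_mem_box_of_le (hP : P.IsAdmissible) {n m : ℕ} (h : n ≤ m) {a : G} {x : P.Space}
    (hx : x ∈ P.box n a) : ∃ b ∈ blockSet P.C n m, x ∈ P.box m (a * b) := by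
  induction m, h using Nat.le_induction with
  | base => exact ⟨1, hP.one_mem_blockSet le_rfl, by rwa [mul_one]⟩
  | succ m hm ih =>
    obtain ⟨b, hb, hx⟩ := ih
    obtain ⟨c, hc, hx⟩ := exists_mem_box_succ hP hx
    refine ⟨b * c, ?_, by rwa [← mul_assoc]⟩
    rw [blockSet_succ _ hm]
    exact Set.mul_mem_mul hb hc

theorem box_mul_subset (hP : P.IsAdmissible) {n m : ℕ} (h : n ≤ m) {a b : G} (ha : a ∈ P.F n)
    (hb : b ∈ blockSet P.C n m) : P.box m (a * b) ⊆ P.box n a := by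
  induction m, h using Nat.le_induction generalizing b with
  | base =>
    rw [blockSet_self] at hb
    rw [Set.mem_one.1 hb, mul_one]
  | succ m hm ih =>
    rw [blockSet_succ _ hm] at hb
    obtain ⟨b, hb, c, hc, rfl⟩ := hb
    dsimp only
    rw [← mul_assoc]
    exact (box_succ_subset hP (hP.mul_mem_F hm ha hb) hc).trans (ih hb)

theorem box_eq_iUnion (hP : P.IsAdmissible) {n m : ℕ} (h : n ≤ m) {a : G} (ha : a ∈ P.F n) :
    P.box n a = ⋃ b, ⋃ _ : b ∈ blockSet P.C n m, P.box m (a * b) := by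
  refine Set.Subset.antisymm (fun x hx => ?_)
    (Set.iUnion₂_subset fun b hb => box_mul_subset hP h ha hb)
  obtain ⟨b, hb, hx⟩ := exists_mem_box_of_le hP h hx
  exact Set.mem_iUnion₂.2 ⟨b, hb, hx⟩

theorem box_inter_box_of_le (hP : P.IsAdmissible) {n m : ℕ} (h : n ≤ m) {a : G} (ha : a ∈ P.F n)
    (b : G) [Decidable (a⁻¹ * b ∈ blockSet P.C n m)] :
    P.box n a ∩ P.box m b = if a⁻¹ * b ∈ blockSet P.C n m then P.box m b else ∅ := by
  split_ifs with hb
  · rw [Set.inter_eq_right]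
    simpa only [mul_inv_cancel_left] using box_mul_subset hP h ha hb
  · refine Set.eq_empty_of_forall_notMem fun x ⟨hxa, hxb⟩ => hb ?_
    obtain ⟨b', hb', hxb'⟩ := exists_mem_box_of_le hP h hxa
    rwa [eq_of_mem_box hP hxb hxb', inv_mul_cancel_left]

/-- The part `X_n` of the `(C,F)`-space. -/
def level (P : CFData G) (n : ℕ) : Set P.Space := {x | ∃ a, x ∈ P.box n a}

theorem level_mono (hP : P.IsAdmissible) : Monotone P.level := fun n m h x ⟨a, ha⟩ => by
  obtain ⟨b, -, hb⟩ := exists_mem_box_of_le hP h ha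
  exact ⟨_, hb⟩

theorem iUnion_level (hP : P.IsAdmissible) : ⋃ n, P.level n = Set.univ :=
  Set.eq_univ_of_forall fun x => Set.mem_iUnion.2 (exists_mem_box hP x)

theorem eventually_mem_level (hP : P.IsAdmissible) (x : P.Space) :
    ∀ᶠ n in atTop, x ∈ P.level n := by
  obtain ⟨n, hn⟩ := exists_mem_box hP x
  filter_upwards [eventually_ge_atTop n] with m hm using level_mono hP hm hn

open Classical in
/-- The `F n`-coordinate of a point of `X_n`; it takes the value `1` outside `X_n`. -/
noncomputable def coord (P : CFData G) (n : ℕ) (x : P.Space) : G :=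
  if h : x ∈ P.level n then h.choose else 1

theorem mem_box_coord {n : ℕ} {x : P.Space} (h : x ∈ P.level n) : x ∈ P.box n (P.coord n x) := by
  rw [coord, dif_pos h]
  exact h.choose_spec

theorem coord_mem_F (hP : P.IsAdmissible) (n : ℕ) (x : P.Space) : P.coord n x ∈ P.F n := by
  by_cases h : x ∈ P.level n
  · exact mem_F_of_mem_box (mem_box_coord h)
  · rw [coord, dif_neg h]
    exact hP.one_mem_F n

theorem coord_eq (hP : P.IsAdmissible) {n : ℕ} {a : G} {x : P.Space} (h : x ∈ P.box n a) :
    P.coord n x = a := eq_of_mem_box hP (mem_box_coord ⟨a, h⟩) h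

theorem mem_box_iff (hP : P.IsAdmissible) {n : ℕ} {a : G} {x : P.Space} :
    x ∈ P.box n a ↔ x ∈ P.level n ∧ P.coord n x = a :=
  ⟨fun h => ⟨⟨a, h⟩, coord_eq hP h⟩, fun ⟨h, e⟩ => e ▸ mem_box_coord h⟩

/-- The product `c_n * ⋯ * c_{m-1}` of the entries of a point of `X_n` by which its
`F m`-coordinate differs from its `F n`-coordinate; it is meaningless outside `X_n`. -/
noncomputable def increment (P : CFData G) (n m : ℕ) (x : P.Space) : G :=
  (P.coord n x)⁻¹ * P.coord m x

theorem coord_mul_increment (n m : ℕ) (x : P.Space) :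
    P.coord n x * P.increment n m x = P.coord m x := mul_inv_cancel_left _ _

theorem increment_mem_blockSet (hP : P.IsAdmissible) {n m : ℕ} (h : n ≤ m) {x : P.Space}
    (hx : x ∈ P.level n) : P.increment n m x ∈ blockSet P.C n m := by
  obtain ⟨b, hb, hxb⟩ := exists_mem_box_of_le hP h (mem_box_coord hx)
  rwa [increment, coord_eq hP hxb, inv_mul_cancel_left]

theorem mem_box_iff_of_le (hP : P.IsAdmissible) {n m : ℕ} (h : n ≤ m) {a : G} (ha : a ∈ P.F n)
    {x : P.Space} : x ∈ P.box n a ↔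
      x ∈ P.level m ∧ a⁻¹ * P.coord m x ∈ blockSet P.C n m := by
  constructor
  · intro hx
    refine ⟨level_mono hP h ⟨a, hx⟩, ?_⟩
    simpa only [increment, coord_eq hP hx] using increment_mem_blockSet hP h ⟨a, hx⟩
  · rintro ⟨hx, hmem⟩
    refine box_mul_subset hP h ha hmem ?_
    rw [mul_inv_cancel_left]
    exact mem_box_coord hx

theorem box_inter_box_mul (hP : P.IsAdmissible) {n m : ℕ} (h : n ≤ m) (a b : G) :
    P.box n a ∩ P.box m (a * b) =
      P.level n ∩ {x | P.coord n x = a ∧ P.increment n m x = b} := by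
  ext x
  constructor
  · rintro ⟨hxa, hxb⟩
    refine ⟨⟨a, hxa⟩, coord_eq hP hxa, ?_⟩
    rw [increment, coord_eq hP hxa, coord_eq hP hxb, inv_mul_cancel_left]
  · rintro ⟨hx, rfl, rfl⟩
    rw [coord_mul_increment]
    exact ⟨mem_box_coord hx, mem_box_coord (level_mono hP h hx)⟩

theorem level_eq_of_le (hP : P.IsAdmissible) {n m : ℕ} (h : n ≤ m) :
    P.level n = P.level m ∩ P.coord m ⁻¹' (P.F n * blockSet P.C n m) := by
  ext x
  constructor
  · intro hx
    refine ⟨level_mono hP h hx, _, coord_mem_F hP n x, _, increment_mem_blockSet hP h hx, ?_⟩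
    exact coord_mul_increment n m x
  · rintro ⟨hx, a, ha, b, hb, hab⟩
    exact ⟨a, box_mul_subset hP h ha hb ((mem_box_iff hP).2 ⟨hx, hab.symm⟩)⟩

theorem box_one_eq (hP : P.IsAdmissible) {n m : ℕ} (h : n ≤ m) :
    P.box n 1 = P.level m ∩ P.coord m ⁻¹' blockSet P.C n m := by
  ext x
  rw [mem_box_iff_of_le hP h (hP.one_mem_F n), inv_one, one_mul]
  rfl

theorem germ_eq (hP : P.IsAdmissible) (x : P.Space) :
    x.germ = ((fun n => P.coord n x : ℕ → G) : Germ atTop G) := by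
  obtain ⟨n, z, rfl⟩ := exists_eq_point x
  refine Germ.coe_eq.2 ?_
  filter_upwards [eventually_ge_atTop n] with m hm
  exact (coord_eq hP ((point_mem_box_iff hP hm _ _).2 rfl)).symm

theorem eventually_mem_box_of_germ_eq (hP : P.IsAdmissible) {s : ℕ → G} {x : P.Space}
    (hx : x.germ = (s : Germ atTop G)) : ∀ᶠ n in atTop, x ∈ P.box n (s n) := by
  rw [germ_eq hP, Germ.coe_eq] at hx
  filter_upwards [hx, eventually_mem_level hP x] with n hn hlevel
  rw [← hn]
  exact mem_box_coord hlevel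

/-- A sequence which is, from some index on, the sequence of the coordinates of a point. -/
def IsEventualPath (P : CFData G) (s : ℕ → G) : Prop :=
  ∃ N, ∀ n, N ≤ n → s n ∈ P.F n ∧ (s n)⁻¹ * s (n + 1) ∈ P.C n

theorem IsEventualPath.isPoint (hP : P.IsAdmissible) {s : ℕ → G} (hs : P.IsEventualPath s) :
    P.IsPoint (s : Germ atTop G) := by
  classical
  obtain ⟨N, hN⟩ := hs
  refine ⟨N, ⟨s N, (hN N le_rfl).1⟩,
    fun k => if hk : N ≤ k then ⟨_, (hN k hk).2⟩ else ⟨1, hP.one_mem_C k⟩, ?_⟩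
  refine Germ.coe_eq.2 ?_
  filter_upwards [eventually_ge_atTop N] with m hm
  induction m, hm using Nat.le_induction with
  | base => rw [path_of_le _ _ le_rfl]
  | succ m hm ih =>
    rw [path_succ _ _ hm, ← ih]
    simp [hm]

theorem isPoint_coe_iff (hP : P.IsAdmissible) {s : ℕ → G} :
    P.IsPoint (s : Germ atTop G) ↔ P.IsEventualPath s := by
  refine ⟨fun ⟨n, f, c, h⟩ => ?_, IsEventualPath.isPoint hP⟩
  obtain ⟨N, hN⟩ := eventually_atTop.1 (Germ.coe_eq.1 h)
  refine ⟨max n N, fun m hm => ?_⟩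
  rw [hN m (by omega), hN (m + 1) (by omega), path_succ _ _ (by omega), inv_mul_cancel_left]
  exact ⟨path_mem hP (by omega) f c, (c m).2⟩

theorem isEventualPath_coord (hP : P.IsAdmissible) (x : P.Space) :
    P.IsEventualPath fun n => P.coord n x :=
  (isPoint_coe_iff hP).1 (germ_eq hP x ▸ x.isPoint)

open Classical in
/-- The point whose coordinates are eventually `s n`; it is an arbitrary point if there is none. -/
noncomputable def ofCoord (hP : P.IsAdmissible) (s : ℕ → G) : P.Space :=
  if h : P.IsEventualPath s then ⟨(s : Germ atTop G), h.isPoint hP⟩ else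
    P.point 0 (⟨1, hP.one_mem_F 0⟩, fun k => ⟨1, hP.one_mem_C k⟩)

theorem ofCoord_coord (hP : P.IsAdmissible) (x : P.Space) :
    P.ofCoord hP (fun n => P.coord n x) = x := by
  rw [ofCoord, dif_pos (isEventualPath_coord hP x)]
  exact Space.ext (germ_eq hP x).symm

theorem ofCoord_mem_box_iff (hP : P.IsAdmissible) {s : ℕ → G} (hs : P.IsEventualPath s) {n : ℕ}
    {a : G} (ha : a ∈ P.F n) : P.ofCoord hP s ∈ P.box n a ↔
      ∀ᶠ m in atTop, a⁻¹ * s m ∈ blockSet P.C n m := by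
  have hbox : ∀ᶠ m in atTop, P.ofCoord hP s ∈ P.box m (s m) :=
    eventually_mem_box_of_germ_eq hP (by rw [ofCoord, dif_pos hs])
  have hiff : ∀ᶠ m in atTop, P.ofCoord hP s ∈ P.box n a ↔ a⁻¹ * s m ∈ blockSet P.C n m := by
    filter_upwards [hbox, eventually_ge_atTop n] with m hm hnm
    rw [mem_box_iff_of_le hP hnm ha, coord_eq hP hm]
    exact and_iff_right ⟨_, hm⟩
  exact ⟨fun h => hiff.mono fun m hm => hm.1 h, fun h => (hiff.and h).exists.elim fun m hm =>
    hm.1.2 hm.2⟩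

/-- The set on which `T g` is given by left multiplication of some coordinate. -/
def dom (P : CFData G) (g : G) : Set P.Space :=
  {x | ∃ n f, x ∈ P.box n f ∧ g * f ∈ P.F n}

theorem T_mem_box {n : ℕ} {f g : G} {x : P.Space} (hx : x ∈ P.box n f)
    (h : g * f ∈ P.F n) : P.T g x ∈ P.box n (g * f) := by
  obtain ⟨hf, c, rfl⟩ := hx
  rw [T_point P g n ⟨f, hf⟩ c h]
  exact ⟨h, c, rfl⟩

theorem T_T {n : ℕ} {f g h : G} {x : P.Space} (hx : x ∈ P.box n f) (hg : g * f ∈ P.F n)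
    (hh : h * (g * f) ∈ P.F n) : P.T h (P.T g x) = P.T (h * g) x := by
  obtain ⟨hf, c, rfl⟩ := hx
  rw [T_point P g n ⟨f, hf⟩ c hg, T_point P h n ⟨g * f, hg⟩ c hh,
    T_point P (h * g) n ⟨f, hf⟩ c (mul_assoc h g f ▸ hh)]
  simp only [mul_assoc]

theorem T_eq_self_of_notMem_dom (hP : P.IsAdmissible) {g : G} {x : P.Space} (hx : x ∉ P.dom g) :
    P.T g x = x := by
  refine dif_neg fun h => hx ?_
  rw [germ_eq hP, Germ.map_coe, isPoint_coe_iff hP] at h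
  obtain ⟨N, hN⟩ := h
  obtain ⟨n, hn, hNn⟩ := ((eventually_mem_level hP x).and (eventually_ge_atTop N)).exists
  exact ⟨n, _, mem_box_coord hn, (hN n hNn).1⟩

theorem mul_coord_mem_F_of_le (hP : P.IsAdmissible) {n N : ℕ} {f g : G} {x : P.Space} (h : N ≤ n)
    (hx : x ∈ P.box N f) (hg : g * f ∈ P.F N) : g * P.coord n x ∈ P.F n := by
  rw [← coord_mul_increment N n, coord_eq hP hx, ← mul_assoc]
  exact hP.mul_mem_F h hg (increment_mem_blockSet hP h ⟨f, hx⟩)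

theorem T_mem_box_iff (hP : P.IsAdmissible) {n N : ℕ} {a f g : G} {x : P.Space} (h : N ≤ n)
    (hx : x ∈ P.box N f) (hg : g * f ∈ P.F N) : P.T g x ∈ P.box n a ↔ x ∈ P.box n (g⁻¹ * a) := by
  have hxn : x ∈ P.box n (P.coord n x) := mem_box_coord (level_mono hP h ⟨f, hx⟩)
  have hTx := T_mem_box hxn (mul_coord_mem_F_of_le hP h hx hg)
  constructor
  · intro hTa
    rwa [← eq_of_mem_box hP hTx hTa, inv_mul_cancel_left]
  · intro hxa
    rwa [eq_of_mem_box hP hxn hxa, mul_inv_cancel_left] at hTx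

theorem eventually_T_mem_box (hP : P.IsAdmissible) {g : G} {x : P.Space} (hx : x ∈ P.dom g) :
    ∀ᶠ n in atTop, x ∈ P.level n ∧ g * P.coord n x ∈ P.F n ∧
      P.T g x ∈ P.box n (g * P.coord n x) := by
  obtain ⟨N, f, hxf, hgf⟩ := hx
  filter_upwards [eventually_ge_atTop N] with n hn
  have hlevel : x ∈ P.level n := level_mono hP hn ⟨f, hxf⟩
  have hmem := mul_coord_mem_F_of_le hP hn hxf hgf
  exact ⟨hlevel, hmem, T_mem_box (mem_box_coord hlevel) hmem⟩

theorem T_mem_box_iff_exists (hP : P.IsAdmissible) {g a : G} {n : ℕ} {x : P.Space}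
    (hx : x ∈ P.dom g) (ha : a ∈ P.F n) :
    P.T g x ∈ P.box n a ↔ ∃ m, n ≤ m ∧ x ∈ P.level m ∧ g * P.coord m x ∈ P.F m ∧
      a⁻¹ * (g * P.coord m x) ∈ blockSet P.C n m := by
  constructor
  · intro h
    obtain ⟨m, ⟨hlevel, hmem, hbox⟩, hnm⟩ :=
      ((eventually_T_mem_box hP hx).and (eventually_ge_atTop n)).exists
    rw [mem_box_iff_of_le hP hnm ha, coord_eq hP hbox] at h
    exact ⟨m, hnm, hlevel, hmem, h.2⟩
  · rintro ⟨m, hnm, hlevel, hmem, hblock⟩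
    have hbox := T_mem_box (mem_box_coord hlevel) hmem
    rw [mem_box_iff_of_le hP hnm ha, coord_eq hP hbox]
    exact ⟨⟨_, hbox⟩, hblock⟩

theorem T_mem_box_iff_of_mem_F (hP : P.IsAdmissible) {g a : G} {n : ℕ} {x : P.Space}
    (hx : x ∈ P.dom g) (ha : a ∈ P.F n) (hga : g⁻¹ * a ∈ P.F n) :
    P.T g x ∈ P.box n a ↔ x ∈ P.box n (g⁻¹ * a) := by
  refine ⟨fun h => ?_, fun h => ?_⟩
  · obtain ⟨m, hnm, hlevel, -, hblock⟩ := (T_mem_box_iff_exists hP hx ha).1 h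
    rw [mem_box_iff_of_le hP hnm hga]
    exact ⟨hlevel, by rwa [mul_inv_rev, inv_inv, mul_assoc]⟩
  · have hTx := T_mem_box (g := g) h (by rwa [mul_inv_cancel_left])
    rwa [mul_inv_cancel_left] at hTx

theorem measurableSet_box (n : ℕ) (a : G) : MeasurableSet (P.box n a) := by
  by_cases h : a ∈ P.F n
  · rw [box_eq_cylinder ⟨a, h⟩]
    exact MeasurableSpace.measurableSet_generateFrom ⟨n, _, rfl⟩
  · rw [box_eq_empty h]
    exact MeasurableSet.empty

theorem measurable_of_box {α : Type*} [MeasurableSpace α] {f : α → P.Space}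
    (h : ∀ n, ∀ a ∈ P.F n, MeasurableSet (f ⁻¹' P.box n a)) : Measurable f := by
  refine measurable_generateFrom ?_
  rintro _ ⟨n, a, rfl⟩
  rw [← box_eq_cylinder]
  exact h n a a.2

theorem isPiSystem_box (hP : P.IsAdmissible) (N : ℕ) :
    IsPiSystem {A | ∃ n, N ≤ n ∧ ∃ a, A = P.box n a} := by
  classical
  rintro _ ⟨n, hn, a, rfl⟩ _ ⟨m, hm, b, rfl⟩ hne
  wlog hnm : n ≤ m generalizing n m a b
  · rw [Set.inter_comm] at hne ⊢
    exact this m hm b n hn a hne (le_of_not_ge hnm)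
  have ha := mem_F_of_mem_box hne.some_mem.1
  rw [box_inter_box_of_le hP hnm ha] at hne ⊢
  split_ifs at hne ⊢
  · exact ⟨m, hm, b, rfl⟩
  · exact absurd hne Set.not_nonempty_empty

variable [Countable G]

theorem generateFrom_box (hP : P.IsAdmissible) {N : Set ℕ} (hN : IsCofinal N) :
    (inferInstance : MeasurableSpace P.Space) =
      MeasurableSpace.generateFrom {A | ∃ n ∈ N, ∃ a, A = P.box n a} := by
  refine le_antisymm (MeasurableSpace.generateFrom_le ?_) (MeasurableSpace.generateFrom_le ?_)
  · rintro _ ⟨n, a, rfl⟩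
    obtain ⟨m, hm, hnm⟩ := hN n
    rw [← box_eq_cylinder, box_eq_iUnion hP hnm a.2]
    refine @MeasurableSet.iUnion _ _ (MeasurableSpace.generateFrom _) _ _ fun b =>
      @MeasurableSet.iUnion _ _ (MeasurableSpace.generateFrom _) _ _ fun _ =>
      MeasurableSpace.measurableSet_generateFrom ⟨m, hm, _, rfl⟩
  · rintro _ ⟨n, -, a, rfl⟩
    exact measurableSet_box n a

theorem measurableSet_level (n : ℕ) : MeasurableSet (P.level n) := by
  have : P.level n = ⋃ a, P.box n a := by
    ext x
    simp [level]
  rw [this]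
  exact MeasurableSet.iUnion fun a => measurableSet_box n a

theorem measurableSet_dom (g : G) : MeasurableSet (P.dom g) := by
  have : P.dom g = ⋃ n, ⋃ f, ⋃ _ : g * f ∈ P.F n, P.box n f := by
    ext x
    simp [dom, and_comm]
  rw [this]
  exact MeasurableSet.iUnion fun n => MeasurableSet.iUnion fun f => MeasurableSet.iUnion fun _ =>
    measurableSet_box n f

theorem measurable_coord (hP : P.IsAdmissible) (n : ℕ) : Measurable (P.coord n) := by
  refine measurable_to_countable' fun a => ?_
  have hlevel : P.coord n ⁻¹' {a} ∩ P.level n = P.box n a := by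
    ext x
    rw [mem_box_iff hP]
    exact and_comm
  have hcompl : P.coord n ⁻¹' {a} ∩ (P.level n)ᶜ = {x | x ∉ P.level n ∧ 1 = a} := by
    ext x
    refine ⟨fun ⟨hx, hn⟩ => ⟨hn, ?_⟩, fun ⟨hn, hx⟩ => ⟨?_, hn⟩⟩
    · rwa [Set.mem_preimage, coord, dif_neg hn] at hx
    · rwa [Set.mem_preimage, coord, dif_neg hn]
  rw [← Set.inter_union_compl (P.coord n ⁻¹' {a}) (P.level n), hlevel, hcompl]
  exact (measurableSet_box n a).union ((measurableSet_level n).compl.inter (MeasurableSet.const _))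

theorem measurable_T [DiscreteMeasurableSpace G] (hP : P.IsAdmissible) (g : G) :
    Measurable (P.T g) := by
  refine measurable_of_box fun n a ha => ?_
  have hpre : P.T g ⁻¹' P.box n a = (P.box n a \ P.dom g) ∪ (P.dom g ∩ ⋃ m, ⋃ _ : n ≤ m,
      P.level m ∩ P.coord m ⁻¹' {s | g * s ∈ P.F m ∧ a⁻¹ * (g * s) ∈ blockSet P.C n m}) := by
    ext x
    by_cases hx : x ∈ P.dom g
    · simp [hx, T_mem_box_iff_exists hP hx ha, and_left_comm]
    · simp [hx, T_eq_self_of_notMem_dom hP hx]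
  rw [hpre]
  exact ((measurableSet_box n a).diff (measurableSet_dom g)).union ((measurableSet_dom g).inter
    (MeasurableSet.iUnion fun m => MeasurableSet.iUnion fun _ =>
      (measurableSet_level m).inter (measurable_coord hP m MeasurableSet.of_discrete)))

/-! ### The measure -/

theorem ext_of_box (hP : P.IsAdmissible) (N : ℕ) {μ₁ μ₂ : Measure P.Space}
    (hfin : ∀ n a, μ₁ (P.box n a) ≠ ∞)
    (h : ∀ n, N ≤ n → ∀ a, μ₁ (P.box n a) = μ₂ (P.box n a)) : μ₁ = μ₂ := by
  refine Measure.ext_of_generateFrom_of_cover_subset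
    (T := Set.range fun p : {n // N ≤ n} × G => P.box p.1 p.2)
    (generateFrom_box hP (isCofinal_Ici N)) (isPiSystem_box hP N) ?_
    (Set.countable_range _) ?_ ?_ ?_
  · rintro _ ⟨⟨n, a⟩, rfl⟩
    exact ⟨n, n.2, a, rfl⟩
  · refine Set.eq_univ_of_forall fun x => ?_
    obtain ⟨n, ⟨a, hn⟩, hN⟩ := ((eventually_mem_level hP x).and (eventually_ge_atTop N)).exists
    exact ⟨_, ⟨(⟨n, hN⟩, a), rfl⟩, hn⟩
  · rintro _ ⟨⟨n, a⟩, rfl⟩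
    exact hfin n a
  · rintro _ ⟨n, hn, a, rfl⟩
    exact h n hn a

variable [DiscreteMeasurableSpace G]

theorem measurable_increment (hP : P.IsAdmissible) (n m : ℕ) : Measurable (P.increment n m) :=
  (measurable_coord hP n).inv.mul (measurable_coord hP m)

theorem measure_box (hP : P.IsAdmissible) (n : ℕ) (a : G) :
    P.measure hP (P.box n a) = P.ν n {a} := by
  by_cases h : a ∈ P.F n
  · rw [box_eq_cylinder ⟨a, h⟩, measure_cylinder]
  · rw [box_eq_empty h, hP.ν_eq_zero h, measure_empty]

theorem measure_box_ne_top (hP : P.IsAdmissible) (n : ℕ) (a : G) :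
    P.measure hP (P.box n a) ≠ ∞ := by
  rw [measure_box]
  exact hP.ν_ne_top n _

theorem measure_ne_zero (hP : P.IsAdmissible) : P.measure hP ≠ 0 := fun h =>
  hP.ν_one_ne_zero 0 (by rw [← measure_box hP, h, Measure.coe_zero, Pi.zero_apply])

theorem measure_box_inter_box (hP : P.IsAdmissible) {n m : ℕ} (h : n ≤ m) (a b : G) :
    P.measure hP (P.box n a ∩ P.box m b) = P.ν n {a} * blockConv P.κ n m {a⁻¹ * b} := by
  classical
  by_cases ha : a ∈ P.F n
  · rw [box_inter_box_of_le hP h ha]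
    split_ifs with hb
    · rw [measure_box, ← hP.ν_singleton_mul h ha hb, mul_inv_cancel_left]
    · rw [measure_mono_null (Set.singleton_subset_iff.2 hb) (hP.blockConv_compl n m), mul_zero,
        measure_empty]
  · rw [box_eq_empty ha, hP.ν_eq_zero ha, zero_mul, Set.empty_inter, measure_empty]

theorem map_coord (hP : P.IsAdmissible) (n : ℕ) :
    ((P.measure hP).restrict (P.level n)).map (P.coord n) = P.ν n := by
  refine Measure.ext_of_singleton fun a => ?_
  rw [Measure.map_apply (measurable_coord hP n) MeasurableSet.of_discrete,
    Measure.restrict_apply' (measurableSet_level n), ← measure_box hP]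
  congr 1
  ext x
  rw [mem_box_iff hP]
  exact and_comm

theorem measure_level_inter_coord (hP : P.IsAdmissible) (n : ℕ) (S : Set G) :
    P.measure hP (P.level n ∩ P.coord n ⁻¹' S) = P.ν n S := by
  rw [← map_coord hP, Measure.map_apply (measurable_coord hP n) MeasurableSet.of_discrete,
    Measure.restrict_apply' (measurableSet_level n), Set.inter_comm]

theorem measure_level (hP : P.IsAdmissible) (n : ℕ) :
    P.measure hP (P.level n) = P.ν n (P.F n) := by
  rw [← measure_level_inter_coord hP, Set.preimage_eq_univ_iff.2, Set.inter_univ]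
  rintro _ ⟨x, rfl⟩
  exact coord_mem_F hP n x

theorem measure_level_ne_top (hP : P.IsAdmissible) (n : ℕ) : P.measure hP (P.level n) ≠ ∞ := by
  rw [measure_level]
  exact hP.ν_ne_top n _

theorem measure_level_inter_coord_inter (hP : P.IsAdmissible) (n : ℕ) (S : Set G)
    {A : Set P.Space} (hA : MeasurableSet A) :
    P.measure hP (P.level n ∩ P.coord n ⁻¹' S ∩ A) = ∑' f : S, P.measure hP (P.box n f ∩ A) := by
  have hunion : P.level n ∩ P.coord n ⁻¹' S ∩ A = ⋃ f : S, P.box n f ∩ A := by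
    rw [← Set.iUnion_inter]
    ext x
    simp [mem_box_iff hP]
  rw [hunion, measure_iUnion _ fun f => (measurableSet_box _ _).inter hA]
  exact fun f f' hne => Set.disjoint_left.2 fun x hx hx' =>
    hne (Subtype.ext (eq_of_mem_box hP hx.1 hx'.1))

instance sigmaFinite_measure (hP : P.IsAdmissible) : SigmaFinite (P.measure hP) :=
  ⟨⟨⟨P.level, fun _ => trivial, fun n => (measure_level_ne_top hP n).lt_top, iUnion_level hP⟩⟩⟩

instance isFiniteMeasure_restrict_level (hP : P.IsAdmissible) (n : ℕ) :
    IsFiniteMeasure ((P.measure hP).restrict (P.level n)) :=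
  isFiniteMeasure_restrict.2 (measure_level_ne_top hP n)

theorem map_coord_increment (hP : P.IsAdmissible) {n m : ℕ} (h : n ≤ m) :
    ((P.measure hP).restrict (P.level n)).map (fun x => (P.coord n x, P.increment n m x)) =
      (P.ν n).prod (blockConv P.κ n m) := by
  have := hP.prob_κ
  refine Measure.ext_of_singleton fun ⟨a, b⟩ => ?_
  rw [Measure.map_apply ((measurable_coord hP n).prodMk (measurable_increment hP n m))
      MeasurableSet.of_discrete, Measure.restrict_apply' (measurableSet_level n),
    ← Set.singleton_prod_singleton, Measure.prod_prod, ← inv_mul_cancel_left a b,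
    ← measure_box_inter_box hP h, inv_mul_cancel_left, box_inter_box_mul hP h, Set.inter_comm]
  rfl

theorem measure_level_inter_coord_increment (hP : P.IsAdmissible) {n m : ℕ} (h : n ≤ m)
    (S B : Set G) :
    P.measure hP (P.level n ∩ {x | P.coord n x ∈ S ∧ P.increment n m x ∈ B}) =
      P.ν n S * blockConv P.κ n m B := by
  have := hP.prob_κ
  rw [← Measure.prod_prod, ← map_coord_increment hP h,
    Measure.map_apply ((measurable_coord hP n).prodMk (measurable_increment hP n m))
      MeasurableSet.of_discrete, Measure.restrict_apply' (measurableSet_level n), Set.inter_comm]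
  rfl

theorem measure_level_inter_increment (hP : P.IsAdmissible) {N n m : ℕ} (hN : N ≤ n) (h : n ≤ m)
    (B : Set G) : P.measure hP (P.level N ∩ P.increment n m ⁻¹' B) =
      P.measure hP (P.level N) * blockConv P.κ n m B := by
  rw [level_eq_of_le hP hN, measure_level_inter_coord hP,
    ← measure_level_inter_coord_increment hP h, Set.inter_assoc]
  rfl

/-! ### Nonsingularity and ergodicity of the action -/

theorem measure_compl_dom (hP : P.IsAdmissible) (g : G) : P.measure hP (P.dom g)ᶜ = 0 := by
  have measure_level_diff_dom (n : ℕ) : P.measure hP (P.level n \ P.dom g) = 0 := by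
    have hle : ∀ m ≥ n, P.measure hP (P.level n \ P.dom g) +
        P.ν m ((P.F n * blockSet P.C n m) ∩ {x | g * x ∈ P.F m}) ≤ P.ν n (P.F n) := by
      intro m hm
      rw [← measure_level_inter_coord hP, ← measure_level hP, Set.preimage_inter,
        ← Set.inter_assoc, ← level_eq_of_le hP hm, add_comm, ← measure_inter_add_sdiff (P.level n)
        (measurableSet_dom g)]
      refine add_le_add_left (measure_mono ?_) _
      rintro x ⟨hx, hgx⟩
      exact ⟨hx, m, _, mem_box_coord (level_mono hP hm hx), hgx⟩
    have hlim := le_of_tendsto ((hP.conull g n).const_add _) (eventually_atTop.2 ⟨n, hle⟩)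
    by_contra hne
    rw [add_comm] at hlim
    exact (ENNReal.lt_add_right (hP.ν_ne_top n _) hne).not_ge hlim
  rw [Set.compl_eq_univ_sdiff, ← iUnion_level hP, Set.iUnion_sdiff]
  exact measure_iUnion_null measure_level_diff_dom

theorem ae_mem_dom (hP : P.IsAdmissible) (g : G) : ∀ᵐ x ∂P.measure hP, x ∈ P.dom g :=
  measure_compl_dom hP g

theorem measure_box_inter_T_preimage_box (hP : P.IsAdmissible) {n k : ℕ} (hk : n ≤ k) {g f : G}
    (hg : g * f ∈ P.F n) (a : G) :
    P.ν n {g * f} * P.measure hP (P.box n f ∩ P.T g ⁻¹' P.box k a) =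
      P.ν n {f} * P.measure hP (P.box n (g * f) ∩ P.box k a) := by
  have hpre : P.box n f ∩ P.T g ⁻¹' P.box k a = P.box n f ∩ P.box k (g⁻¹ * a) := by
    ext x
    exact and_congr_right fun hx => T_mem_box_iff hP hk hx hg
  rw [hpre, measure_box_inter_box hP hk, measure_box_inter_box hP hk, mul_left_comm, mul_inv_rev,
    mul_assoc]

theorem measure_box_inter_T_preimage (hP : P.IsAdmissible) {n : ℕ} {g f : G}
    (hg : g * f ∈ P.F n) {A : Set P.Space} (hA : MeasurableSet A) :
    P.ν n {g * f} * P.measure hP (P.box n f ∩ P.T g ⁻¹' A) =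
      P.ν n {f} * P.measure hP (P.box n (g * f) ∩ A) := by
  have map_apply {B : Set P.Space} (hB : MeasurableSet B) :
      (P.ν n {g * f} • ((P.measure hP).restrict (P.box n f)).map (P.T g)) B =
        P.ν n {g * f} * P.measure hP (P.box n f ∩ P.T g ⁻¹' B) := by
    rw [Measure.smul_apply, Measure.map_apply (measurable_T hP g) hB,
      Measure.restrict_apply' (measurableSet_box n f), Set.inter_comm, smul_eq_mul]
  have restrict_apply (B : Set P.Space) :
      (P.ν n {f} • (P.measure hP).restrict (P.box n (g * f))) B =
        P.ν n {f} * P.measure hP (P.box n (g * f) ∩ B) := by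
    rw [Measure.smul_apply, Measure.restrict_apply' (measurableSet_box n _), Set.inter_comm,
      smul_eq_mul]
  rw [← map_apply hA, ← restrict_apply]
  congr 1
  refine ext_of_box hP n (fun k a => ?_) (fun k hk a => ?_)
  · rw [map_apply (measurableSet_box k a)]
    exact ENNReal.mul_ne_top (hP.ν_ne_top n _)
      (measure_ne_top_of_subset Set.inter_subset_left (measure_box_ne_top hP n f))
  · rw [map_apply (measurableSet_box k a), restrict_apply]
    exact measure_box_inter_T_preimage_box hP hk hg a

theorem quasiMeasurePreserving_T (hP : P.IsAdmissible) (g : G) :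
    Measure.QuasiMeasurePreserving (P.T g) (P.measure hP) (P.measure hP) := by
  refine ⟨measurable_T hP g, Measure.AbsolutelyContinuous.mk fun A hA hA₀ => ?_⟩
  rw [Measure.map_apply (measurable_T hP g) hA]
  have hsub : P.T g ⁻¹' A ⊆ (P.dom g)ᶜ ∪
      ⋃ n, ⋃ f, ⋃ _ : g * f ∈ P.F n, P.box n f ∩ P.T g ⁻¹' A := fun x hx =>
    or_iff_not_imp_left.2 fun hdom => by
      obtain ⟨n, f, hxf, hgf⟩ := not_not.1 hdom
      exact Set.mem_iUnion.2 ⟨n, Set.mem_iUnion₂.2 ⟨f, hgf, hxf, hx⟩⟩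
  refine measure_mono_null hsub (measure_union_null (measure_compl_dom hP g)
    (measure_iUnion_null fun n => measure_iUnion_null fun f => measure_iUnion_null fun hgf => ?_))
  have h := measure_box_inter_T_preimage hP hgf hA
  rw [measure_mono_null Set.inter_subset_right hA₀, mul_zero] at h
  exact (mul_eq_zero.1 h).resolve_left (hP.ν_pos n _ hgf)

theorem exists_measure_level_inter_coord_inter_of_invariant (hP : P.IsAdmissible)
    {A : Set P.Space} (hA : MeasurableSet A) (hinv : ∀ g, P.T g ⁻¹' A =ᵐ[P.measure hP] A) (n : ℕ) :
    ∃ r : ℝ≥0∞, ∀ S : Set G,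
      P.measure hP (P.level n ∩ P.coord n ⁻¹' S ∩ A) = r * P.ν n S := by
  set μ := P.measure hP
  set r : ℝ≥0∞ := μ (P.box n 1 ∩ A) / P.ν n {1}
  have measure_box_inter (f : G) : μ (P.box n f ∩ A) = r * P.ν n {f} := by
    by_cases hf : f ∈ P.F n
    · have h := measure_box_inter_T_preimage hP (n := n) (f := 1) (mul_one f ▸ hf) hA
      rw [mul_one, measure_congr ((ae_eq_refl (P.box n 1)).inter (hinv f)), mul_comm] at h
      rw [← ENNReal.mul_div_right_comm, h,
        ENNReal.eq_div_iff (hP.ν_one_ne_zero n) (hP.ν_ne_top n _)]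
    · rw [box_eq_empty hf, hP.ν_eq_zero hf, Set.empty_inter, measure_empty, mul_zero]
  refine ⟨r, fun S => ?_⟩
  rw [measure_level_inter_coord_inter hP n S hA, measure_eq_tsum_singleton (P.ν n),
    ← ENNReal.tsum_mul_left]
  exact tsum_congr fun f => measure_box_inter f

theorem exists_restrict_eq_smul_of_invariant (hP : P.IsAdmissible) {A : Set P.Space}
    (hA : MeasurableSet A) (hinv : ∀ g, P.T g ⁻¹' A =ᵐ[P.measure hP] A) :
    ∃ r : ℝ≥0∞, (P.measure hP).restrict A = r • P.measure hP := by
  choose r hr using exists_measure_level_inter_coord_inter_of_invariant hP hA hinv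
  have r_mul_box (n : ℕ) : P.measure hP (P.box 0 1 ∩ A) = r n * P.measure hP (P.box 0 1) := by
    rw [box_one_eq hP n.zero_le, hr, measure_level_inter_coord]
  have r_eq (n : ℕ) : r n = P.measure hP (P.box 0 1 ∩ A) := by
    rw [r_mul_box n, measure_box, hP.ν_zero, Measure.dirac_apply_of_mem (Set.mem_singleton _),
      mul_one]
  refine ⟨P.measure hP (P.box 0 1 ∩ A), ext_of_box hP 0 (fun n a => ?_) fun n _ a => ?_⟩
  · rw [Measure.restrict_apply' hA]
    exact measure_ne_top_of_subset Set.inter_subset_left (measure_box_ne_top hP n a)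
  · have hbox : P.box n a = P.level n ∩ P.coord n ⁻¹' {a} := Set.ext fun x => mem_box_iff hP
    rw [Measure.restrict_apply' hA, hbox, hr, r_eq, Measure.smul_apply,
      measure_level_inter_coord, smul_eq_mul]

theorem ergodic_T (hP : P.IsAdmissible) {A : Set P.Space} (hA : MeasurableSet A)
    (hinv : ∀ g, P.T g ⁻¹' A =ᵐ[P.measure hP] A) :
    P.measure hP A = 0 ∨ P.measure hP Aᶜ = 0 := by
  obtain ⟨r, hr⟩ := exists_restrict_eq_smul_of_invariant hP hA hinv
  have hcompl : r * P.measure hP Aᶜ = 0 := by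
    rw [← smul_eq_mul, ← Measure.smul_apply, ← hr, Measure.restrict_apply' hA,
      Set.compl_inter_self, measure_empty]
  have hself : P.measure hP A = r * P.measure hP A := by
    rw [← smul_eq_mul, ← Measure.smul_apply, ← hr, Measure.restrict_apply_self]
  refine (mul_eq_zero.1 hcompl).imp (fun hr₀ => ?_) id
  rw [hself, hr₀, zero_mul]

end CFData

/-! ### Approximation of measurable sets -/

theorem eventually_exists_measure_symmDiff_preimage_le {α : Type*} {β : ℕ → Type*}
    [mα : MeasurableSpace α] {μ : Measure α} [IsFiniteMeasure μ] {f : ∀ m, α → β m}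
    {𝒮 : Set (Set α)} (hgen : mα = MeasurableSpace.generateFrom 𝒮)
    (h𝒮 : ∀ B ∈ 𝒮, ∀ᶠ m in atTop, ∃ D : Set (β m), B =ᵐ[μ] f m ⁻¹' D)
    {A : Set α} (hA : MeasurableSet A) {ε : ℝ≥0∞} (hε : 0 < ε) :
    ∀ᶠ m in atTop, ∃ D : Set (β m), μ (symmDiff A (f m ⁻¹' D)) ≤ ε := by
  set 𝒜 : Set (Set α) :=
    {B | MeasurableSet B ∧ ∀ᶠ m in atTop, ∃ D : Set (β m), B =ᵐ[μ] f m ⁻¹' D}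
  have isSetAlgebra_𝒜 : IsSetAlgebra 𝒜 := by
    refine ⟨⟨MeasurableSet.empty, Eventually.of_forall fun m => ⟨∅, ae_eq_refl _⟩⟩, ?_, ?_⟩
    · rintro B ⟨hB, h⟩
      exact ⟨hB.compl, h.mono fun m ⟨D, hD⟩ => ⟨Dᶜ, hD.compl⟩⟩
    · rintro B B' ⟨hB, h⟩ ⟨hB', h'⟩
      exact ⟨hB.union hB', (h.and h').mono fun m ⟨⟨D, hD⟩, D', hD'⟩ => ⟨D ∪ D', hD.union hD'⟩⟩
  have generateFrom_𝒜 : mα = MeasurableSpace.generateFrom 𝒜 := by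
    refine le_antisymm ?_ (MeasurableSpace.generateFrom_le fun B hB => hB.1)
    refine hgen.le.trans (MeasurableSpace.generateFrom_mono fun B hB => ⟨?_, h𝒮 B hB⟩)
    rw [hgen]
    exact MeasurableSpace.measurableSet_generateFrom hB
  obtain ⟨B, ⟨-, hB⟩, hBA⟩ := exists_measure_symmDiff_lt_of_generateFrom_isSetRing (μ := μ)
    isSetAlgebra_𝒜.isSetRing ⟨{Set.univ}, Set.countable_singleton _,
      Set.singleton_subset_iff.2 isSetAlgebra_𝒜.univ_mem, by simp⟩ generateFrom_𝒜 hA hε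
  filter_upwards [hB] with m ⟨D, hD⟩
  refine ⟨D, ?_⟩
  rw [symmDiff_comm, ← measure_congr (hD.symmDiff (ae_eq_refl A))]
  exact hBA.le

namespace CFData

variable {G : Type*} [Group G] [MeasurableSpace G] [DiscreteMeasurableSpace G] [Countable G]
  {P : CFData G}

theorem eventually_exists_measure_symmDiff_coord_le (hP : P.IsAdmissible) (n : ℕ)
    {A : Set P.Space} (hA : MeasurableSet A) {ε : ℝ≥0∞} (hε : 0 < ε) : ∀ᶠ m in atTop,
      ∃ S : Set G, P.measure hP (P.level n ∩ symmDiff A (P.coord m ⁻¹' S)) ≤ ε := by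
  refine (eventually_exists_measure_symmDiff_preimage_le
    (μ := (P.measure hP).restrict (P.level n)) (f := P.coord)
    (generateFrom_box hP (isCofinal_Ici n)) ?_ hA hε).mono fun m ⟨S, hS⟩ => ⟨S, ?_⟩
  · rintro _ ⟨k, hk, a, rfl⟩
    filter_upwards [eventually_ge_atTop k] with m hm
    by_cases ha : a ∈ P.F k
    · refine ⟨{s | a⁻¹ * s ∈ blockSet P.C k m}, ?_⟩
      filter_upwards [ae_restrict_mem (measurableSet_level n)] with x hx
      refine propext ((mem_box_iff_of_le hP hm ha).trans (and_iff_right ?_))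
      exact level_mono hP (hk.trans hm) hx
    · exact ⟨∅, by rw [box_eq_empty ha, Set.preimage_empty]; exact ae_eq_refl _⟩
  · rwa [Measure.restrict_apply' (measurableSet_level n), Set.inter_comm] at hS

end CFData

/-! ### Odometers -/

theorem measurableSet_setOf_eventually {α : Type*} [MeasurableSpace α] {p : ℕ → α → Prop}
    (h : ∀ n, MeasurableSet {x | p n x}) : MeasurableSet {x | ∀ᶠ n in atTop, p n x} := by
  convert MeasurableSet.measurableSet_liminf h using 1
  ext x
  exact mem_liminf_iff_eventually_mem.symm

section Quotient

variable {G : Type*} [Group G] (H : Subgroup G)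

instance [Countable G] : Countable (G ⧸ H) := QuotientGroup.mk_surjective.countable

theorem quotientGroup_mk_eq_of_le {H K : Subgroup G} (h : H ≤ K) {g g' : G}
    (he : (g : G ⧸ H) = g') : (g : G ⧸ K) = g' :=
  QuotientGroup.eq.2 (h (QuotientGroup.eq.1 he))

end Quotient

namespace OdometerSpace

variable {G : Type*} [Group G] {Γ : ℕ → Subgroup G}

@[simp]
theorem smul_coord (g : G) (y : OdometerSpace Γ) (n : ℕ) : (g • y).coord n = g • y.coord n := rfl

theorem coord_eq_of_le (y : OdometerSpace Γ) {l m : ℕ} (h : l ≤ m) {g : G}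
    (hg : y.coord m = (g : G ⧸ Γ m)) : y.coord l = (g : G ⧸ Γ l) := by
  induction m, h using Nat.le_induction with
  | base => exact hg
  | succ m _ ih => exact ih (y.coherent m g hg)

theorem exists_coord_preimage_eq_of_le {l m : ℕ} (h : l ≤ m) (D : Set (G ⧸ Γ l)) :
    ∃ E : Set (G ⧸ Γ m), {y : OdometerSpace Γ | y.coord l ∈ D} = {y | y.coord m ∈ E} := by
  refine ⟨{a | ∃ g : G, a = g ∧ (g : G ⧸ Γ l) ∈ D}, Set.ext fun y => ⟨fun hy => ?_, ?_⟩⟩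
  · obtain ⟨g, hg⟩ := QuotientGroup.mk_surjective (y.coord m)
    exact ⟨g, hg.symm, coord_eq_of_le y h hg.symm ▸ hy⟩
  · rintro ⟨g, hg, hgD⟩
    rwa [Set.mem_ofPred_eq, coord_eq_of_le y h hg]

variable [MeasurableSpace G]

theorem measurable_iff {α : Type*} [MeasurableSpace α] {f : α → OdometerSpace Γ} :
    Measurable f ↔ ∀ n, Measurable fun x => (f x).coord n :=
  measurable_comap_iff.trans measurable_pi_iff

theorem measurable_coord (n : ℕ) : Measurable fun y : OdometerSpace Γ => y.coord n :=
  measurable_iff.1 measurable_id n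

variable [DiscreteMeasurableSpace G]

theorem measurable_smul (g : G) : Measurable fun y : OdometerSpace Γ => g • y :=
  measurable_iff.2 fun n =>
    (Measurable.of_discrete (f := fun a : G ⧸ Γ n => g • a)).comp (measurable_coord n)

theorem generateFrom_coord :
    (inferInstance : MeasurableSpace (OdometerSpace Γ)) = MeasurableSpace.generateFrom
      {B | ∃ (l : ℕ) (D : Set (G ⧸ Γ l)), B = {y | y.coord l ∈ D}} := by
  set 𝒮 : Set (Set (OdometerSpace Γ)) :=
    {B | ∃ (l : ℕ) (D : Set (G ⧸ Γ l)), B = {y | y.coord l ∈ D}}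
  refine le_antisymm (fun A hA => ?_) (MeasurableSpace.generateFrom_le ?_)
  · exact (@measurable_iff _ _ Γ _ _ (MeasurableSpace.generateFrom 𝒮) id).2
      (fun n D _ => MeasurableSpace.measurableSet_generateFrom ⟨n, D, rfl⟩) hA
  · rintro _ ⟨l, D, rfl⟩
    exact measurable_coord l MeasurableSet.of_discrete

theorem exists_measure_symmDiff_coord_le (μ : Measure (OdometerSpace Γ)) [IsFiniteMeasure μ]
    {A : Set (OdometerSpace Γ)} (hA : MeasurableSet A) {ε : ℝ≥0∞} (hε : 0 < ε) :
    ∃ (l : ℕ) (D : Set (G ⧸ Γ l)), μ (symmDiff A {y | y.coord l ∈ D}) ≤ ε := by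
  refine (eventually_exists_measure_symmDiff_preimage_le (μ := μ) (f := fun l y => y.coord l)
    generateFrom_coord ?_ hA hε).exists
  rintro _ ⟨l, D, rfl⟩
  filter_upwards [eventually_ge_atTop l] with m hm
  obtain ⟨E, hE⟩ := exists_coord_preimage_eq_of_le hm D
  exact ⟨E, hE ▸ ae_eq_refl _⟩

end OdometerSpace

namespace CFData

variable {G : Type*} [Group G] [MeasurableSpace G] {P : CFData G} {Γ : ℕ → Subgroup G}

section Image

variable [DiscreteMeasurableSpace G] [Countable G]

theorem isNonsingularOdometer_map (hP : P.IsAdmissible) {π : P.Space → OdometerSpace Γ}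
    (hπ : Measurable π) (he : ∀ g : G, ∀ᵐ x ∂P.measure hP, π (P.T g x) = g • π x) :
    IsNonsingularOdometer Γ ((P.measure hP).toFinite.map π) where
  sigmaFinite := inferInstance
  ne_zero := by
    rw [Ne, Measure.map_eq_zero_iff hπ.aemeasurable]
    intro h
    refine measure_ne_zero hP (Measure.absolutelyContinuous_zero_iff.1 ?_)
    exact h ▸ absolutelyContinuous_toFinite (P.measure hP)
  quasiInvariant g := by
    refine ⟨OdometerSpace.measurable_smul g, ?_⟩
    have hT : (P.measure hP).toFinite.map (P.T g) ≪ (P.measure hP).toFinite :=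
      ((toFinite_absolutelyContinuous _).map (measurable_T hP g)).trans
        ((quasiMeasurePreserving_T hP g).absolutelyContinuous.trans
          (absolutelyContinuous_toFinite _))
    have hcomm : (fun x => g • π x) =ᵐ[(P.measure hP).toFinite] fun x => π (P.T g x) :=
      (toFinite_absolutelyContinuous _).ae_le ((he g).mono fun x hx => hx.symm)
    rw [Measure.map_map (OdometerSpace.measurable_smul g) hπ]
    change (P.measure hP).toFinite.map (fun x => g • π x) ≪ _
    rw [Measure.map_congr hcomm]
    exact (Measure.map_map hπ (measurable_T hP g)).symm ▸ hT.map hπ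
  ergodic A hA hinv := by
    have hπA (g : G) : P.T g ⁻¹' (π ⁻¹' A) =ᵐ[P.measure hP] π ⁻¹' A := by
      filter_upwards [he g, absolutelyContinuous_toFinite (P.measure hP)
        (ae_of_ae_map hπ.aemeasurable (hinv g))] with x hx hxA
      refine Eq.trans ?_ hxA
      change (π (P.T g x) ∈ A) = (g • π x ∈ A)
      rw [hx]
    rw [Measure.map_apply hπ hA, Measure.map_apply hπ hA.compl]
    exact (ergodic_T hP (hπ hA) hπA).imp (fun h => toFinite_absolutelyContinuous _ h)
      fun h => toFinite_absolutelyContinuous _ h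

theorem hasFactor_map (hP : P.IsAdmissible) {π : P.Space → OdometerSpace Γ}
    (hπ : Measurable π) (he : ∀ g : G, ∀ᵐ x ∂P.measure hP, π (P.T g x) = g • π x) :
    P.HasFactor hP Γ ((P.measure hP).toFinite.map π) :=
  ⟨π, hπ, he, (absolutelyContinuous_toFinite _).map hπ, (toFinite_absolutelyContinuous _).map hπ⟩

end Image

/-! ### The limit map of a compatible telescoping -/

/-- For every `l`, the coset modulo `Γ l` of the `F (q k)`-coordinate of `x` does not depend on `k`
for large `k`; so the cosets converge to a point of the odometer. -/
def Stabilizes (P : CFData G) (Γ : ℕ → Subgroup G) (q : ℕ → ℕ) (x : P.Space) : Prop :=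
  ∀ l, EventuallyConst (fun k => (P.coord (q k) x : G ⧸ Γ l)) atTop

theorem stabilizes_iff {q : ℕ → ℕ} {x : P.Space} : P.Stabilizes Γ q x ↔
    ∀ l, ∃ a : G ⧸ Γ l, ∀ᶠ k in atTop, (P.coord (q k) x : G ⧸ Γ l) = a :=
  forall_congr' fun _ => eventuallyConst_iff_exists_eventuallyEq

open Classical in
/-- The map to the odometer which sends `x` to the limit of the cosets of its
`F (q k)`-coordinates, or to the base point if these do not converge. -/
noncomputable def limitMap (P : CFData G) (hΓ : Antitone Γ) (q : ℕ → ℕ) (x : P.Space) :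
    OdometerSpace Γ :=
  if h : P.Stabilizes Γ q x then
    ⟨fun l => (stabilizes_iff.1 h l).choose, fun l g hg => by
      obtain ⟨k, hk, hk'⟩ := ((stabilizes_iff.1 h l).choose_spec.and
        (stabilizes_iff.1 h (l + 1)).choose_spec).exists
      rw [← hk]
      exact quotientGroup_mk_eq_of_le (hΓ (Nat.le_succ l)) (hk'.trans hg)⟩
  else
    ⟨fun l => ((1 : G) : G ⧸ Γ l), fun l _ => quotientGroup_mk_eq_of_le (hΓ (Nat.le_succ l))⟩

theorem Stabilizes.eventually_eq {q : ℕ → ℕ} {x : P.Space} (h : P.Stabilizes Γ q x)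
    (hΓ : Antitone Γ) (l : ℕ) :
    ∀ᶠ k in atTop, (P.coord (q k) x : G ⧸ Γ l) = (P.limitMap hΓ q x).coord l := by
  rw [limitMap, dif_pos h]
  exact (stabilizes_iff.1 h l).choose_spec

theorem Stabilizes.limitMap_coord_eq_iff {q : ℕ → ℕ} {x : P.Space} (h : P.Stabilizes Γ q x)
    (hΓ : Antitone Γ) {l : ℕ} {a : G ⧸ Γ l} :
    (P.limitMap hΓ q x).coord l = a ↔ ∀ᶠ k in atTop, (P.coord (q k) x : G ⧸ Γ l) = a := by
  refine ⟨fun ha => ha ▸ h.eventually_eq hΓ l, fun ha => ?_⟩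
  obtain ⟨k, hk, hka⟩ := ((h.eventually_eq hΓ l).and ha).exists
  exact hk.symm.trans hka

theorem Stabilizes.limitMap_T (hP : P.IsAdmissible) {q : ℕ → ℕ} (hq : Tendsto q atTop atTop)
    {x : P.Space} (h : P.Stabilizes Γ q x) (hΓ : Antitone Γ) {g : G} (hx : x ∈ P.dom g) :
    P.limitMap hΓ q (P.T g x) = g • P.limitMap hΓ q x := by
  have hlim (l : ℕ) : ∀ᶠ k in atTop, (P.coord (q k) (P.T g x) : G ⧸ Γ l) =
      g • (P.limitMap hΓ q x).coord l := by
    filter_upwards [hq.eventually (eventually_T_mem_box hP hx), h.eventually_eq hΓ l]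
      with k hk hkl
    rw [coord_eq hP hk.2.2, ← hkl]
    rfl
  exact OdometerSpace.ext (funext fun l =>
    ((stabilizes_iff.2 fun l => ⟨_, hlim l⟩).limitMap_coord_eq_iff hΓ).2 (hlim l))

variable [DiscreteMeasurableSpace G] [Countable G]

theorem measurableSet_eventually_coord_eq (hP : P.IsAdmissible) (q : ℕ → ℕ) (l : ℕ) (a : G ⧸ Γ l) :
    MeasurableSet {x : P.Space | ∀ᶠ k in atTop, (P.coord (q k) x : G ⧸ Γ l) = a} :=
  measurableSet_setOf_eventually fun k =>
    measurable_coord hP (q k) (MeasurableSet.of_discrete (s := {g : G | (g : G ⧸ Γ l) = a}))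

theorem measurableSet_stabilizes (hP : P.IsAdmissible) (q : ℕ → ℕ) :
    MeasurableSet {x : P.Space | P.Stabilizes Γ q x} := by
  simp only [stabilizes_iff, Set.ofPred_forall, Set.ofPred_exists]
  exact MeasurableSet.iInter fun l => MeasurableSet.iUnion fun a =>
    measurableSet_eventually_coord_eq hP q l a

theorem measurable_limitMap (hP : P.IsAdmissible) (hΓ : Antitone Γ) (q : ℕ → ℕ) :
    Measurable (P.limitMap hΓ q) := by
  refine OdometerSpace.measurable_iff.2 fun l => measurable_to_countable' fun a => ?_
  have hset : (fun x : P.Space => (P.limitMap hΓ q x).coord l) ⁻¹' {a} =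
      {x | P.Stabilizes Γ q x}.ite {x | ∀ᶠ k in atTop, (P.coord (q k) x : G ⧸ Γ l) = a}
        {_x | ((1 : G) : G ⧸ Γ l) = a} := by
    ext x
    by_cases h : P.Stabilizes Γ q x
    · simpa [Set.ite, h] using h.limitMap_coord_eq_iff hΓ
    · simp [Set.ite, h, limitMap]
  rw [hset]
  exact (measurableSet_stabilizes hP q).ite (measurableSet_eventually_coord_eq hP q l a)
    (MeasurableSet.const _)

theorem ae_eventually_increment_notMem (hP : P.IsAdmissible) {q : ℕ → ℕ} (hq : StrictMono q)
    {B : ℕ → Set G} (hB : ∑' n, blockConv P.κ (q n) (q (n + 1)) (B n) ≠ ∞) :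
    ∀ᵐ x ∂P.measure hP, ∀ᶠ n in atTop, P.increment (q n) (q (n + 1)) x ∉ B n := by
  rw [← Measure.restrict_univ (μ := P.measure hP), ← iUnion_level hP, ae_restrict_iUnion_iff]
  intro N
  have hmeasure (n : ℕ) : (P.measure hP).restrict (P.level N)
      (P.increment (q (n + N)) (q (n + N + 1)) ⁻¹' B (n + N)) =
        P.measure hP (P.level N) * blockConv P.κ (q (n + N)) (q (n + N + 1)) (B (n + N)) := by
    rw [Measure.restrict_apply' (measurableSet_level N), Set.inter_comm,
      measure_level_inter_increment hP (le_trans (Nat.le_add_left N n) hq.le_apply)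
        (hq.monotone (Nat.le_succ _))]
  have hsum : ∑' n, (P.measure hP).restrict (P.level N)
      (P.increment (q (n + N)) (q (n + N + 1)) ⁻¹' B (n + N)) ≠ ∞ := by
    simp only [hmeasure, ENNReal.tsum_mul_left]
    refine ENNReal.mul_ne_top (measure_level_ne_top hP N) (ne_top_of_le_ne_top hB ?_)
    exact ENNReal.tsum_comp_le_tsum_of_injective (add_left_injective N)
      fun n => blockConv P.κ (q n) (q (n + 1)) (B n)
  filter_upwards [ae_eventually_notMem hsum] with x hx
  rwa [← map_add_atTop_eq_nat N, eventually_map]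

theorem ae_stabilizes (hP : P.IsAdmissible) (hΓ : Antitone Γ) {q : ℕ → ℕ} (hq : StrictMono q)
    (hc : (P.telescope q).IsCompatible Γ) : ∀ᵐ x ∂P.measure hP, P.Stabilizes Γ q x := by
  filter_upwards [ae_eventually_increment_notMem hP hq hc.ne] with x hx l
  obtain ⟨K, hK⟩ := eventually_atTop.1 ((hx.and (eventually_ge_atTop l)).and
    (hq.tendsto_atTop.eventually (eventually_mem_level hP x)))
  refine eventuallyConst_atTop_nat.2 ⟨K, fun k hk => ?_⟩
  obtain ⟨⟨hinc, hlk⟩, hlevel⟩ := hK k hk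
  have hblock := increment_mem_blockSet hP (hq.monotone (Nat.le_succ k)) hlevel
  rw [eq_comm, QuotientGroup.eq]
  exact hΓ hlk (not_not.1 fun hnot => hinc ⟨hblock, hnot⟩)

theorem ae_limitMap_T (hP : P.IsAdmissible) (hΓ : Antitone Γ) {q : ℕ → ℕ} (hq : StrictMono q)
    (hc : (P.telescope q).IsCompatible Γ) (g : G) :
    ∀ᵐ x ∂P.measure hP, P.limitMap hΓ q (P.T g x) = g • P.limitMap hΓ q x := by
  filter_upwards [ae_stabilizes hP hΓ hq hc, ae_mem_dom hP g] with x hx hdom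
  exact hx.limitMap_T hP hq.tendsto_atTop hΓ hdom

end CFData

namespace OdometerSpace

variable {G : Type*} [Group G] {Γ : ℕ → Subgroup G}

/-- The sequence of the stabilizers of the coordinates of a point `y` of the odometer. It plays the
role of `Γ` when `y` is taken as the base point. -/
def stab (y : OdometerSpace Γ) (n : ℕ) : Subgroup G := MulAction.stabilizer G (y.coord n)

theorem stab_eq_map_conj (y : OdometerSpace Γ) {n : ℕ} {g : G} (h : y.coord n = (g : G ⧸ Γ n)) :
    y.stab n = (Γ n).map (MulAut.conj g).toMonoidHom := by
  have hg : (g : G ⧸ Γ n) = g • ((1 : G) : G ⧸ Γ n) := congrArg _ (mul_one g).symm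
  rw [stab, h, hg, MulAction.stabilizer_smul_eq_stabilizer_map_conj, MulAction.stabilizer_quotient]

theorem isOdometerSequence_stab (hΓ : IsOdometerSequence Γ) (y : OdometerSpace Γ) :
    IsOdometerSequence y.stab where
  strictAnti := by
    refine strictAnti_nat_of_succ_lt fun n => ?_
    obtain ⟨g, hg⟩ := QuotientGroup.mk_surjective (y.coord (n + 1))
    rw [stab_eq_map_conj y hg.symm, stab_eq_map_conj y (y.coherent n g hg.symm),
      Subgroup.map_lt_map_iff_of_injective (MulAut.conj g).injective]
    exact hΓ.strictAnti (Nat.lt_succ_self n)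
  finiteIndex n := by
    obtain ⟨g, hg⟩ := QuotientGroup.mk_surjective (y.coord n)
    rw [stab_eq_map_conj y hg.symm]
    exact ⟨(Subgroup.index_map_equiv (Γ n) (MulAut.conj g)).trans_ne
      (hΓ.finiteIndex n).index_ne_zero⟩
  iInter_conj := by
    refine Set.Subset.antisymm ?_ (Set.singleton_subset_iff.2
      (Set.mem_iInter₂.2 fun n g => ⟨1, one_mem _, by group⟩))
    rw [← hΓ.iInter_conj]
    refine Set.subset_iInter₂ fun n g x hx => ?_
    obtain ⟨h, hh⟩ := QuotientGroup.mk_surjective (y.coord n)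
    obtain ⟨_, hγ, rfl⟩ := Set.mem_iInter₂.1 hx n (g * h⁻¹)
    rw [stab_eq_map_conj y hh.symm] at hγ
    obtain ⟨γ, hγ, rfl⟩ := hγ
    exact ⟨γ, hγ, by simp [mul_assoc]⟩

end OdometerSpace

/-! ### Approximate constancy of an equivariant map on the boxes -/

namespace CFData

variable {G : Type*} [Group G] [MeasurableSpace G] [DiscreteMeasurableSpace G] {P : CFData G}
  {Γ : ℕ → Subgroup G} {hP : P.IsAdmissible} {π : P.Space → OdometerSpace Γ}

/-- The proportion of the box of `1` in `X_n` on which the `l`-th coordinate of the map `π` differs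
from the coset `a`. -/
noncomputable def defect (P : CFData G) (hP : P.IsAdmissible) (π : P.Space → OdometerSpace Γ)
    (n l : ℕ) (a : G ⧸ Γ l) : ℝ≥0∞ :=
  P.measure hP (P.box n 1 ∩ {x | (π x).coord l ≠ a}) / P.ν n {1}

theorem measure_box_one_inter_ne (n l : ℕ) (a : G ⧸ Γ l) :
    P.measure hP (P.box n 1 ∩ {x | (π x).coord l ≠ a}) = P.defect hP π n l a * P.ν n {1} := by
  rw [defect, ENNReal.div_mul_cancel (hP.ν_one_ne_zero n) (hP.ν_ne_top n _)]

theorem measurableSet_coord_mem (hπ : Measurable π) (l : ℕ) (D : Set (G ⧸ Γ l)) :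
    MeasurableSet {x | (π x).coord l ∈ D} :=
  ((OdometerSpace.measurable_coord l).comp hπ) (MeasurableSet.of_discrete (s := D))

theorem measurableSet_coord_ne (hπ : Measurable π) (l : ℕ) (a : G ⧸ Γ l) :
    MeasurableSet {x | (π x).coord l ≠ a} :=
  measurableSet_coord_mem hπ l {a}ᶜ

variable [Countable G]

theorem exists_coord_eq_of_defect_add_lt_one {n l k : ℕ} {a : G ⧸ Γ l} {b : G ⧸ Γ k}
    (h : P.defect hP π n l a + P.defect hP π n k b < 1) :
    ∃ x, (π x).coord l = a ∧ (π x).coord k = b := by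
  by_contra! hne
  have hsub : P.box n 1 ⊆ (P.box n 1 ∩ {x | (π x).coord l ≠ a}) ∪
      (P.box n 1 ∩ {x | (π x).coord k ≠ b}) := fun x hx =>
    (em ((π x).coord l = a)).elim (fun hxa => Or.inr ⟨hx, hne x hxa⟩) fun hxa => Or.inl ⟨hx, hxa⟩
  have hle : 1 * P.ν n {1} ≤ (P.defect hP π n l a + P.defect hP π n k b) * P.ν n {1} := by
    rw [one_mul, add_mul, ← measure_box_one_inter_ne, ← measure_box_one_inter_ne, ← measure_box hP]
    exact (measure_mono hsub).trans (measure_union_le _ _)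
  exact h.not_ge ((ENNReal.mul_le_mul_iff_left (hP.ν_one_ne_zero n) (hP.ν_ne_top n _)).1 hle)

theorem measure_box_inter_ne (hπ : Measurable π)
    (he : ∀ g : G, ∀ᵐ x ∂P.measure hP, π (P.T g x) = g • π x) {n : ℕ} {f : G} (hf : f ∈ P.F n)
    (l : ℕ) (a : G ⧸ Γ l) :
    P.measure hP (P.box n f ∩ {x | (π x).coord l ≠ f • a}) =
      P.defect hP π n l a * P.ν n {f} := by
  have hpre : P.T f ⁻¹' {x | (π x).coord l ≠ f • a} =ᵐ[P.measure hP] {x | (π x).coord l ≠ a} := by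
    filter_upwards [he f] with x hx
    change ((π (P.T f x)).coord l ≠ f • a) = ((π x).coord l ≠ a)
    rw [hx, OdometerSpace.smul_coord, Ne, smul_left_cancel_iff]
  have h := measure_box_inter_T_preimage hP ((mul_one f).symm ▸ hf)
    (measurableSet_coord_ne hπ l (f • a))
  rw [measure_congr ((ae_eq_refl _).inter hpre), measure_box_one_inter_ne, mul_one, ← mul_assoc,
    mul_comm _ (P.ν n {1}), mul_comm (P.ν n {f})] at h
  exact ((ENNReal.mul_right_inj (hP.ν_one_ne_zero n) (hP.ν_ne_top n _)).1 h).symm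

theorem mul_ν_le_measure (hP : P.IsAdmissible) {n : ℕ} {S : Set G} {A : Set P.Space}
    (hA : MeasurableSet A) {r : ℝ≥0∞}
    (h : ∀ f ∈ S, r * P.ν n {f} ≤ P.measure hP (P.box n f ∩ A)) :
    r * P.ν n S ≤ P.measure hP (P.level n ∩ P.coord n ⁻¹' S ∩ A) := by
  rw [measure_level_inter_coord_inter hP n S hA, measure_eq_tsum_singleton (P.ν n),
    ← ENNReal.tsum_mul_left]
  exact ENNReal.tsum_le_tsum fun f => h f f.2

theorem mul_ν_le_measure_coord_ne (hπ : Measurable π)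
    (he : ∀ g : G, ∀ᵐ x ∂P.measure hP, π (P.T g x) = g • π x) {n l : ℕ} {r : ℝ≥0∞}
    (hr : ∀ a, r ≤ P.defect hP π n l a) (S : Set G) (b : G ⧸ Γ l) :
    r * P.ν n S ≤ P.measure hP (P.level n ∩ P.coord n ⁻¹' S ∩ {x | (π x).coord l ≠ b}) := by
  refine mul_ν_le_measure hP (measurableSet_coord_ne hπ l b) fun f _ => ?_
  by_cases hf : f ∈ P.F n
  · rw [← smul_inv_smul f b, measure_box_inter_ne hπ he hf]
    exact mul_le_mul_left (hr _) _
  · rw [hP.ν_eq_zero hf, mul_zero]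
    exact zero_le

theorem exists_measure_level_inter_coord_eq_pos (hP : P.IsAdmissible)
    (π : P.Space → OdometerSpace Γ) (n l : ℕ) :
    ∃ b, 0 < P.measure hP (P.level n ∩ {x | (π x).coord l = b}) := by
  refine exists_measure_pos_of_not_measure_iUnion_null fun h => hP.ν_one_ne_zero n ?_
  have hsub : P.box n 1 ⊆ ⋃ b, P.level n ∩ {x | (π x).coord l = b} := fun x hx =>
    Set.mem_iUnion.2 ⟨(π x).coord l, ⟨1, hx⟩, rfl⟩
  exact measure_box hP n 1 ▸ measure_mono_null hsub h

-- If all defects were at least `ε`, then every union of boxes of `X_m` would meet the complement of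
-- a fibre `E` of the `l`-th coordinate in a proportion `≥ ε` of its measure, so such unions could
-- not approximate `E`.
theorem eventually_exists_defect_lt (hπ : Measurable π)
    (he : ∀ g : G, ∀ᵐ x ∂P.measure hP, π (P.T g x) = g • π x) (l : ℕ) {ε : ℝ≥0∞} (hε : 0 < ε) :
    ∀ᶠ n in atTop, ∃ a, P.defect hP π n l a < ε := by
  wlog hε₁ : ε ≤ 1 generalizing ε
  · exact (this one_pos le_rfl).mono fun n ⟨a, ha⟩ => ⟨a, ha.trans (not_le.1 hε₁)⟩
  obtain ⟨b, hb⟩ := exists_measure_level_inter_coord_eq_pos hP π 0 l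
  set E : Set P.Space := {x | (π x).coord l = b}
  obtain ⟨η, hη₀, hη⟩ : ∃ η > 0, η + η < ε * P.measure hP (P.level 0 ∩ E) := by
    obtain ⟨δ, hδ₀, hδ⟩ := exists_between (ENNReal.mul_pos hε.ne' hb.ne')
    exact ⟨δ / 2, ENNReal.half_pos hδ₀.ne', (ENNReal.add_halves δ).symm ▸ hδ⟩
  filter_upwards [eventually_exists_measure_symmDiff_coord_le hP 0
    (measurableSet_coord_mem hπ l {b}) hη₀] with m ⟨S, hS⟩
  by_contra! hdefect
  have hlevel : P.level 0 ∩ P.coord m ⁻¹' S =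
      P.level m ∩ P.coord m ⁻¹' (P.F 0 * blockSet P.C 0 m ∩ S) := by
    rw [level_eq_of_le hP m.zero_le, Set.preimage_inter, Set.inter_assoc]
  have hEc : ε * P.measure hP (P.level 0 ∩ P.coord m ⁻¹' S) ≤ η := by
    rw [hlevel, measure_level_inter_coord]
    refine (mul_ν_le_measure_coord_ne hπ he hdefect _ b).trans ?_
    rw [← hlevel]
    have hsub : P.level 0 ∩ P.coord m ⁻¹' S ∩ {x | (π x).coord l ≠ b} ⊆
        P.level 0 ∩ symmDiff E (P.coord m ⁻¹' S) := fun x hx => ⟨hx.1.1, Or.inr ⟨hx.1.2, hx.2⟩⟩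
    exact (measure_mono hsub).trans hS
  have hE : P.measure hP (P.level 0 ∩ E) ≤ P.measure hP (P.level 0 ∩ P.coord m ⁻¹' S) + η := by
    refine (measure_mono fun x hx => ?_).trans
      ((measure_union_le _ _).trans (add_le_add_right hS _))
    exact (em (x ∈ P.coord m ⁻¹' S)).imp (fun hxS => ⟨hx.1, hxS⟩)
      fun hxS => ⟨hx.1, Or.inl ⟨hx.2, hxS⟩⟩
  refine hη.not_ge ?_
  calc ε * P.measure hP (P.level 0 ∩ E)
      ≤ ε * P.measure hP (P.level 0 ∩ P.coord m ⁻¹' S) + ε * η := by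
        rw [← mul_add]; exact mul_le_mul_right hE _
    _ ≤ η + η := add_le_add hEc (mul_le_of_le_one_left' hε₁)

theorem exists_tendsto_defect (hΓ : ∀ n, (Γ n).FiniteIndex) (hπ : Measurable π)
    (he : ∀ g : G, ∀ᵐ x ∂P.measure hP, π (P.T g x) = g • π x) : ∃ y : OdometerSpace Γ,
      ∀ l, Tendsto (fun n => P.defect hP π n l (y.coord l)) (hyperfilter ℕ) (𝓝 0) := by
  have exists_eventually_lt (l : ℕ) {ε : ℝ≥0∞} (hε : 0 < ε) :
      ∃ a, ∀ᶠ n in (hyperfilter ℕ : Filter ℕ), P.defect hP π n l a < ε :=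
    Ultrafilter.eventually_exists_iff.1
      (Nat.hyperfilter_le_atTop (eventually_exists_defect_lt hπ he l hε))
  have exists_coord_eq {l k : ℕ} {a : G ⧸ Γ l} {b : G ⧸ Γ k}
      (ha : ∀ᶠ n in (hyperfilter ℕ : Filter ℕ), P.defect hP π n l a < 2⁻¹)
      (hb : ∀ᶠ n in (hyperfilter ℕ : Filter ℕ), P.defect hP π n k b < 2⁻¹) :
      ∃ x, (π x).coord l = a ∧ (π x).coord k = b := by
    obtain ⟨n, hna, hnb⟩ := (ha.and hb).exists
    exact exists_coord_eq_of_defect_add_lt_one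
      ((ENNReal.add_lt_add hna hnb).trans_eq ENNReal.inv_two_add_inv_two)
  have inv_two_pos : (0 : ℝ≥0∞) < 2⁻¹ := by simp
  choose a ha using fun l => exists_eventually_lt l inv_two_pos
  refine ⟨⟨a, fun l g hg => ?_⟩, fun l => ENNReal.tendsto_nhds_zero.2 fun ε hε => ?_⟩
  · obtain ⟨x, hx, hx'⟩ := exists_coord_eq (ha l) (ha (l + 1))
    exact hx ▸ (π x).coherent l g (hx'.trans hg)
  · obtain ⟨b, hb⟩ := exists_eventually_lt l (lt_min hε inv_two_pos)
    obtain ⟨x, hxa, hxb⟩ := exists_coord_eq (ha l)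
      (hb.mono fun n hn => hn.trans_le (min_le_right _ _))
    filter_upwards [hb] with n hn
    exact (hxa.symm.trans hxb) ▸ (hn.trans_le (min_le_left _ _)).le

/-! ### Compatible telescopings from factor maps -/

theorem inv_two_mul_ν_le_of_smul_ne (hπ : Measurable π)
    (he : ∀ g : G, ∀ᵐ x ∂P.measure hP, π (P.T g x) = g • π x) {n l : ℕ} {a : G ⧸ Γ l}
    (ha : P.defect hP π n l a ≤ 2⁻¹) {f : G} (hf : f ∈ P.F n) (hfa : f • a ≠ a) :
    2⁻¹ * P.ν n {f} ≤ P.measure hP (P.box n f ∩ {x | (π x).coord l ≠ a}) := by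
  have hsub : P.box n f ⊆ (P.box n f ∩ {x | (π x).coord l ≠ a}) ∪
      (P.box n f ∩ {x | (π x).coord l ≠ f • a}) := fun x hx =>
    (em ((π x).coord l = a)).elim (fun hxa => Or.inr ⟨hx, fun h => hfa (h.symm.trans hxa)⟩)
      fun hxa => Or.inl ⟨hx, hxa⟩
  have hle : 2⁻¹ * P.ν n {f} + 2⁻¹ * P.ν n {f} ≤
      P.measure hP (P.box n f ∩ {x | (π x).coord l ≠ a}) + 2⁻¹ * P.ν n {f} := by
    rw [← add_mul, ENNReal.inv_two_add_inv_two, one_mul, ← measure_box hP]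
    refine (measure_mono hsub).trans ((measure_union_le _ _).trans (add_le_add_right ?_ _))
    rw [measure_box_inter_ne hπ he hf, measure_box]
    exact mul_le_mul_left ha _
  exact (ENNReal.add_le_add_iff_right
    (ENNReal.mul_ne_top (ENNReal.inv_ne_top.2 two_ne_zero) (hP.ν_ne_top n _))).1 hle

theorem blockConv_smul_ne_le (hπ : Measurable π)
    (he : ∀ g : G, ∀ᵐ x ∂P.measure hP, π (P.T g x) = g • π x) {n m : ℕ} (h : n ≤ m) {l : ℕ}
    {a : G ⧸ Γ l} (ha : P.defect hP π m l a ≤ 2⁻¹) :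
    blockConv P.κ n m {c | c ∈ blockSet P.C n m ∧ c • a ≠ a} ≤ 2 * P.defect hP π n l a := by
  set B : Set G := {c | c ∈ blockSet P.C n m ∧ c • a ≠ a}
  have hB : B ⊆ blockSet P.C n m := fun c hc => hc.1
  have hle : P.ν n {1} * (2⁻¹ * blockConv P.κ n m B) ≤ P.ν n {1} * P.defect hP π n l a := calc
    P.ν n {1} * (2⁻¹ * blockConv P.κ n m B)
      = 2⁻¹ * P.ν m B := by rw [hP.ν_eq_mul_blockConv h hB, mul_left_comm]
    _ ≤ P.measure hP (P.level m ∩ P.coord m ⁻¹' B ∩ {x | (π x).coord l ≠ a}) :=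
      mul_ν_le_measure hP (measurableSet_coord_ne hπ l a) fun f hf =>
        inv_two_mul_ν_le_of_smul_ne hπ he ha (hP.blockSet_subset h hf.1) hf.2
    _ ≤ P.measure hP (P.box n 1 ∩ {x | (π x).coord l ≠ a}) := by
      rw [box_one_eq hP h]
      exact measure_mono (by gcongr)
    _ = P.ν n {1} * P.defect hP π n l a := by rw [measure_box_one_inter_ne, mul_comm]
  rw [mul_comm 2, ← ENNReal.div_le_iff two_ne_zero ENNReal.ofNat_ne_top, ENNReal.div_eq_inv_mul]
  exact (ENNReal.mul_le_mul_iff_right (hP.ν_one_ne_zero n) (hP.ν_ne_top n _)).1 hle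

theorem isCompatible_telescope_stab (hπ : Measurable π)
    (he : ∀ g : G, ∀ᵐ x ∂P.measure hP, π (P.T g x) = g • π x) {y : OdometerSpace Γ} {q : ℕ → ℕ}
    (hq : Monotone q)
    (h : ∀ k, 1 ≤ k → ∀ l ≤ k, P.defect hP π (q k) l (y.coord l) ≤ 2⁻¹ ^ (k + 1)) :
    (P.telescope q).IsCompatible y.stab := by
  have hterm (k : ℕ) :
      (P.telescope q).κ k {c | c ∈ (P.telescope q).C k ∧ c ∉ y.stab k} ≤ 2⁻¹ ^ k := by
    change blockConv P.κ (q k) (q (k + 1))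
      {c | c ∈ blockSet P.C (q k) (q (k + 1)) ∧ c • y.coord k ≠ y.coord k} ≤ 2⁻¹ ^ k
    rcases k.eq_zero_or_pos with rfl | hk
    · have := hP.prob_κ
      rw [pow_zero]
      exact prob_le_one
    · have hle : P.defect hP π (q (k + 1)) k (y.coord k) ≤ 2⁻¹ :=
        (h (k + 1) (by omega) k (by omega)).trans (pow_le_of_le_one zero_le (by simp) (by omega))
      calc _ ≤ 2 * P.defect hP π (q k) k (y.coord k) :=
            blockConv_smul_ne_le hπ he (hq k.le_succ) hle
        _ ≤ 2 * 2⁻¹ ^ (k + 1) := mul_le_mul_right (h k hk k le_rfl) _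
        _ = 2⁻¹ ^ k := by
          rw [pow_succ', ← mul_assoc, ENNReal.mul_inv_cancel two_ne_zero ENNReal.ofNat_ne_top,
            one_mul]
  calc _ ≤ ∑' k, (2⁻¹ : ℝ≥0∞) ^ k := ENNReal.tsum_le_tsum hterm
    _ = 2 := by rw [ENNReal.tsum_geometric, ENNReal.one_sub_inv_two, inv_inv]
    _ < ∞ := ENNReal.ofNat_lt_top

end CFData

theorem exists_strictMono_of_frequently {p : ℕ → ℕ → Prop} (h : ∀ k, ∃ᶠ n in atTop, p k n) :
    ∃ q : ℕ → ℕ, q 0 = 0 ∧ StrictMono q ∧ ∀ k, 1 ≤ k → p k (q k) := by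
  obtain ⟨φ, hφ, hp⟩ := extraction_forall_of_frequently fun k =>
    (h (k + 1)).and_eventually (eventually_gt_atTop 0)
  refine ⟨fun k => k.casesOn 0 φ, rfl, strictMono_nat_of_lt_succ fun k => ?_, fun k hk => ?_⟩
  · cases k with
    | zero => exact (hp 0).2
    | succ k => exact hφ k.lt_succ_self
  · obtain ⟨k, rfl⟩ := Nat.exists_eq_succ_of_ne_zero (Nat.one_le_iff_ne_zero.1 hk)
    exact (hp k).1

namespace CFData

variable {G : Type*} [Group G] [MeasurableSpace G] [DiscreteMeasurableSpace G] [Countable G]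
  {P : CFData G} {Γ : ℕ → Subgroup G} {hP : P.IsAdmissible} {π : P.Space → OdometerSpace Γ}

theorem exists_telescoping_defect_le (hΓ : ∀ n, (Γ n).FiniteIndex) (hπ : Measurable π)
    (he : ∀ g : G, ∀ᵐ x ∂P.measure hP, π (P.T g x) = g • π x) :
    ∃ (y : OdometerSpace Γ) (q : ℕ → ℕ), q 0 = 0 ∧ StrictMono q ∧
      ∀ k, 1 ≤ k → ∀ l ≤ k, P.defect hP π (q k) l (y.coord l) ≤ 2⁻¹ ^ (k + 1) := by
  obtain ⟨y, hy⟩ := exists_tendsto_defect hΓ hπ he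
  have hlarge (k : ℕ) : ∀ᶠ n in (hyperfilter ℕ : Filter ℕ),
      ∀ l ≤ k, P.defect hP π n l (y.coord l) ≤ 2⁻¹ ^ (k + 1) :=
    (Set.finite_Iic k).eventually_all.2 fun l _ =>
      ENNReal.tendsto_nhds_zero.1 (hy l) _ (ENNReal.pow_pos (by simp) _)
  exact ⟨y, exists_strictMono_of_frequently fun k =>
    (hlarge k).frequently.filter_mono Nat.hyperfilter_le_atTop⟩

end CFData

/-! ### Non-atomicity -/

theorem tsum_measure_le_of_encard_le {α ι : Type*} [MeasurableSpace α] [Countable ι]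
    {μ : Measure α} {s : ι → Set α} {t : Set α} {k : ℕ∞} (hs : ∀ i, MeasurableSet (s i))
    (hst : ∀ i, s i ⊆ t) (hk : ∀ᵐ x ∂μ, {i | x ∈ s i}.encard ≤ k) :
    ∑' i, μ (s i) ≤ k * μ t := calc
  ∑' i, μ (s i) = ∑' i, ∫⁻ x in t, (s i).indicator 1 x ∂μ := tsum_congr fun i => by
    rw [lintegral_indicator_one (hs i), Measure.restrict_apply (hs i),
      Set.inter_eq_left.2 (hst i)]
  _ = ∫⁻ x in t, ∑' i, (s i).indicator 1 x ∂μ :=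
    (lintegral_tsum fun i => (measurable_one.indicator (hs i)).aemeasurable).symm
  _ ≤ ∫⁻ _ in t, k ∂μ := lintegral_mono_ae <| (ae_restrict_of_ae hk).mono fun x hx => by
    have hsum : ∑' i, (s i).indicator (1 : α → ℝ≥0∞) x = {i | x ∈ s i}.encard := by
      rw [← ENNReal.tsum_set_one, tsum_subtype {i | x ∈ s i} fun _ => (1 : ℝ≥0∞)]
      rfl
    exact hsum.trans_le (by exact_mod_cast hx)
  _ = k * μ t := by rw [lintegral_const, Measure.restrict_apply_univ]

namespace CFData

variable {G : Type*} [Group G] [MeasurableSpace G] [DiscreteMeasurableSpace G] [Countable G]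
  {P : CFData G}

namespace IsAdmissible

theorem blockConv_singleton_le (hP : P.IsAdmissible) {n m : ℕ} (h : n ≤ m) {b : G}
    (hb : b ∈ blockSet P.C n m) :
    blockConv P.κ n m {b} ≤ ∏ k ∈ Finset.Ico n m, ⨆ c ∈ P.C k, P.κ k {c} := by
  induction m, h using Nat.le_induction generalizing b with
  | base =>
    have := hP.prob_κ
    simpa only [Finset.Ico_self, Finset.prod_empty] using prob_le_one
  | succ m hm ih =>
    rw [blockSet_succ _ hm] at hb
    obtain ⟨b, hb, c, hc, rfl⟩ := hb
    rw [hP.blockConv_succ_singleton hm hb hc, Finset.prod_Ico_succ_top hm]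
    exact mul_le_mul' (ih hb) (le_iSup₂ (f := fun c (_ : c ∈ P.C m) => P.κ m {c}) c hc)

theorem ν_singleton_le (hP : P.IsAdmissible) {n m : ℕ} (h : n ≤ m) {f : G}
    (hf : f ∈ P.F n * blockSet P.C n m) :
    P.ν m {f} ≤ P.ν n (P.F n) * ∏ k ∈ Finset.Ico n m, ⨆ c ∈ P.C k, P.κ k {c} := by
  obtain ⟨a, ha, b, hb, rfl⟩ := hf
  rw [hP.ν_singleton_mul h ha hb]
  exact mul_le_mul' (measure_mono (Set.singleton_subset_iff.2 ha)) (hP.blockConv_singleton_le h hb)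

end IsAdmissible

variable {hP : P.IsAdmissible} {A : Set P.Space} {S : Set G}

theorem ae_encard_T_mem_le (hS : ∀ g ∉ S, ∀ᵐ x ∂P.measure hP, x ∈ A → P.T g x ∉ A) {n : ℕ}
    {L : Set G} (hL : L ⊆ P.F n) :
    ∀ᵐ x ∂P.measure hP, {f : L | x ∈ P.box n 1 ∩ P.T f ⁻¹' A}.encard ≤ S.encard := by
  have hae : ∀ᵐ x ∂P.measure hP, ∀ f g, g ∉ S → P.T f x ∈ A → P.T g (P.T f x) ∉ A :=
    ae_all_iff.2 fun f => (quasiMeasurePreserving_T hP f).ae <|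
      ae_all_iff.2 fun g => eventually_imp_distrib_left.2 (hS g)
  filter_upwards [hae] with x hx
  obtain hempty | ⟨f₀, hbox, hf₀A⟩ :=
    Set.eq_empty_or_nonempty {f : L | x ∈ P.box n 1 ∩ P.T f ⁻¹' A}
  · rw [hempty, Set.encard_empty]
    exact zero_le
  · refine Set.encard_le_encard_of_injOn (f := fun f : L => (f : G) * (f₀ : G)⁻¹)
      (fun f hf => ?_) ((mul_left_injective _).comp Subtype.val_injective).injOn
    by_contra hfS
    refine hx f₀ _ hfS hf₀A ?_
    rw [T_T hbox ((mul_one (f₀ : G)).symm ▸ hL f₀.2)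
      (by rw [mul_one, inv_mul_cancel_right]; exact hL f.2), inv_mul_cancel_right]
    exact hf.2

theorem measure_level_inter_le (hA : MeasurableSet A)
    (hS : ∀ g ∉ S, ∀ᵐ x ∂P.measure hP, x ∈ A → P.T g x ∉ A) {n m : ℕ} (h : n ≤ m) :
    P.measure hP (P.level n ∩ A) ≤
      P.ν n (P.F n) * (∏ k ∈ Finset.Ico n m, ⨆ c ∈ P.C k, P.κ k {c}) * S.encard := by
  set L : Set G := P.F n * blockSet P.C n m
  set r : ℝ≥0∞ := P.ν n (P.F n) * ∏ k ∈ Finset.Ico n m, ⨆ c ∈ P.C k, P.κ k {c}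
  have hLF : L ⊆ P.F m := Set.mul_subset_iff.2 fun a ha b hb => hP.mul_mem_F h ha hb
  have hbox (f : L) : P.ν m {1} * P.measure hP (P.box m f ∩ A) ≤
      r * P.measure hP (P.box m 1 ∩ P.T f ⁻¹' A) := by
    have hT := measure_box_inter_T_preimage hP ((mul_one (f : G)).symm ▸ hLF f.2) hA
    rw [mul_one] at hT
    exact hT.symm.trans_le (mul_le_mul_left (hP.ν_singleton_le h f.2) _)
  have hsum : ∑' f : L, P.measure hP (P.box m 1 ∩ P.T f ⁻¹' A) ≤ S.encard * P.ν m {1} := by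
    rw [← measure_box hP]
    refine tsum_measure_le_of_encard_le
      (fun f => (measurableSet_box m 1).inter (measurable_T hP f hA))
      (fun f => Set.inter_subset_left) (ae_encard_T_mem_le hS hLF)
  have hle : P.ν m {1} * P.measure hP (P.level n ∩ A) ≤ P.ν m {1} * (r * S.encard) := calc
    _ = ∑' f : L, P.ν m {1} * P.measure hP (P.box m f ∩ A) := by
      rw [level_eq_of_le hP h, measure_level_inter_coord_inter hP m L hA, ENNReal.tsum_mul_left]
    _ ≤ r * ∑' f : L, P.measure hP (P.box m 1 ∩ P.T f ⁻¹' A) := by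
      rw [← ENNReal.tsum_mul_left]
      exact ENNReal.tsum_le_tsum hbox
    _ ≤ r * (S.encard * P.ν m {1}) := mul_le_mul_right hsum r
    _ = P.ν m {1} * (r * S.encard) := by ring
  exact (ENNReal.mul_le_mul_iff_right (hP.ν_one_ne_zero m) (hP.ν_ne_top m _)).1 hle

theorem measure_eq_zero_of_finite (hA : MeasurableSet A) (hSfin : S.Finite)
    (hS : ∀ g ∉ S, ∀ᵐ x ∂P.measure hP, x ∈ A → P.T g x ∉ A) : P.measure hP A = 0 := by
  have hlevel (n : ℕ) : P.measure hP (P.level n ∩ A) = 0 := by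
    have hlim : Tendsto (fun m => P.ν n (P.F n) *
        (∏ k ∈ Finset.Ico n m, ⨆ c ∈ P.C k, P.κ k {c}) * S.encard) atTop (𝓝 0) := by
      have := ENNReal.Tendsto.mul_const (ENNReal.Tendsto.const_mul (hP.tendsto_prod_Ico n)
        (Or.inr (hP.ν_ne_top n (P.F n)))) (b := (S.encard : ℝ≥0∞)) (Or.inr (by simpa using hSfin))
      rwa [mul_zero, zero_mul] at this
    exact nonpos_iff_eq_zero.1
      (ge_of_tendsto hlim (eventually_atTop.2 ⟨n, fun m hm => measure_level_inter_le hA hS hm⟩))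
  rw [← Set.univ_inter A, ← iUnion_level hP, Set.iUnion_inter]
  exact measure_iUnion_null hlevel

end CFData

theorem OdometerSpace.measurableSet_eq {G X : Type*} [Group G] [MeasurableSpace G]
    [DiscreteMeasurableSpace G] [Countable G] [MeasurableSpace X] {Γ : ℕ → Subgroup G}
    {f g : X → OdometerSpace Γ} (hf : Measurable f) (hg : Measurable g) :
    MeasurableSet {x | f x = g x} := by
  simp only [OdometerSpace.ext_iff, funext_iff, Set.ofPred_forall]
  exact MeasurableSet.iInter fun n => measurableSet_eq_fun
    ((OdometerSpace.measurable_coord n).comp hf) ((OdometerSpace.measurable_coord n).comp hg)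

theorem CFData.nullSingletonClass_map {G : Type*} [Group G] [MeasurableSpace G]
    [DiscreteMeasurableSpace G] [Countable G] {P : CFData G} {Γ : ℕ → Subgroup G}
    {hP : P.IsAdmissible} {π : P.Space → OdometerSpace Γ} (hπ : Measurable π)
    (he : ∀ g : G, ∀ᵐ x ∂P.measure hP, π (P.T g x) = g • π x)
    (hfin : ∀ y : OdometerSpace Γ, (⋂ n, (y.stab n : Set G)).Finite) :
    NullSingletonClass ((P.measure hP).toFinite.map π) where
  measure_singleton y := by
    have hy : MeasurableSet {z : OdometerSpace Γ | z = y} :=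
      OdometerSpace.measurableSet_eq measurable_id measurable_const
    refine (Measure.map_apply hπ hy).trans (toFinite_absolutelyContinuous _
      (measure_eq_zero_of_finite (hπ hy) (hfin y) fun g hg => ?_))
    filter_upwards [he g] with x hx hxy hgxy
    refine hg (Set.mem_iInter.2 fun n => ?_)
    have hgy : g • y = y := (congrArg (g • ·) hxy).symm.trans (hx.symm.trans hgxy)
    exact congrArg (fun z => z.coord n) hgy

/-! ### Isomorphisms from generating maps -/

theorem exists_measurable_comp_ae_eq {X Y A : Type*} [MeasurableSpace X] [MeasurableSpace Y]
    [Countable A] [Nonempty A] [MeasurableSpace A] {μ : Measure X} {π : X → Y} {f : X → A}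
    (h : ∀ a, ∃ B, MeasurableSet B ∧ f ⁻¹' {a} =ᵐ[μ] π ⁻¹' B) :
    ∃ s : Y → A, Measurable s ∧ ∀ᵐ x ∂μ, s (π x) = f x := by
  classical
  obtain ⟨a, ha⟩ := exists_surjective_nat A
  choose B hB hfB using h
  have hex (y : Y) : ∃ n, y ∈ B (a n) ∪ (⋃ b, B b)ᶜ := by
    by_cases hy : y ∈ ⋃ b, B b
    · obtain ⟨b, hb⟩ := Set.mem_iUnion.1 hy
      obtain ⟨n, rfl⟩ := ha b
      exact ⟨n, Or.inl hb⟩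
    · exact ⟨0, Or.inr hy⟩
  refine ⟨fun y => a (Nat.find (hex y)), Measurable.find (f := fun n _ => a n)
    (p := fun n y => y ∈ B (a n) ∪ (⋃ b, B b)ᶜ) (fun _ => measurable_const)
    (fun n => (hB (a n)).union (MeasurableSet.iUnion hB).compl) hex, ?_⟩
  filter_upwards [ae_all_iff.2 fun b => (hfB b).mem_iff] with x hx
  obtain h | h := Nat.find_spec (hex (π x))
  · exact ((hx _).2 h).symm
  · exact absurd (Set.mem_iUnion.2 ⟨f x, (hx (f x)).1 rfl⟩) h

namespace CFData

variable {G : Type*} [Group G] [MeasurableSpace G] [DiscreteMeasurableSpace G] [Countable G]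
  {P : CFData G}

theorem measurable_ofCoord (hP : P.IsAdmissible) {Y : Type*} [MeasurableSpace Y] {s : ℕ → Y → G}
    (hs : ∀ n, Measurable (s n)) : Measurable fun y => P.ofCoord hP fun n => s n y := by
  refine measurable_of_box fun n a ha => ?_
  have hpath : MeasurableSet {y | P.IsEventualPath fun n => s n y} := by
    simp only [IsEventualPath, ← eventually_atTop]
    exact measurableSet_setOf_eventually fun n => ((hs n).prodMk (hs (n + 1)))
      (MeasurableSet.of_discrete (s := {p : G × G | p.1 ∈ P.F n ∧ p.1⁻¹ * p.2 ∈ P.C n}))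
  have hset : (fun y => P.ofCoord hP fun n => s n y) ⁻¹' P.box n a =
      {y | P.IsEventualPath fun n => s n y}.ite
        {y | ∀ᶠ m in atTop, a⁻¹ * s m y ∈ blockSet P.C n m}
        {_y | P.point 0 (⟨1, hP.one_mem_F 0⟩, fun k => ⟨1, hP.one_mem_C k⟩) ∈ P.box n a} := by
    ext y
    by_cases hy : P.IsEventualPath fun n => s n y
    · simp [Set.ite, hy, ofCoord_mem_box_iff hP hy ha]
    · simp [Set.ite, hy, ofCoord]
  rw [hset]
  exact hpath.ite (measurableSet_setOf_eventually fun m =>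
    hs m (MeasurableSet.of_discrete (s := {g : G | a⁻¹ * g ∈ blockSet P.C n m})))
    (MeasurableSet.const _)

theorem isIsomorphicTo_map {Γ : ℕ → Subgroup G} {hP : P.IsAdmissible}
    {π : P.Space → OdometerSpace Γ} (hπ : Measurable π)
    (he : ∀ g : G, ∀ᵐ x ∂P.measure hP, π (P.T g x) = g • π x)
    (hgen : ∀ A, MeasurableSet A → ∃ B, MeasurableSet B ∧ A =ᵐ[P.measure hP] π ⁻¹' B) :
    P.IsIsomorphicTo hP Γ ((P.measure hP).toFinite.map π) := by
  choose s hs hsπ using fun n => exists_measurable_comp_ae_eq (f := P.coord n) fun a =>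
    hgen _ (measurable_coord hP n MeasurableSet.of_discrete)
  set σ : OdometerSpace Γ → P.Space := fun y => P.ofCoord hP fun n => s n y
  have hσ : Measurable σ := measurable_ofCoord hP hs
  have hσπ : ∀ᵐ x ∂P.measure hP, σ (π x) = x := by
    filter_upwards [ae_all_iff.2 hsπ] with x hx
    simp only [σ, hx, ofCoord_coord]
  have hπσ : ∀ᵐ y ∂(P.measure hP).toFinite.map π, π (σ y) = y :=
    (ae_map_iff hπ.aemeasurable (OdometerSpace.measurableSet_eq (hπ.comp hσ) measurable_id)).2 <|
      toFinite_absolutelyContinuous _ (hσπ.mono fun x hx => congrArg π hx)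
  exact ⟨π, σ, hπ, hσ, hσπ, hπσ, he, (absolutelyContinuous_toFinite _).map hπ,
    (toFinite_absolutelyContinuous _).map hπ⟩

end CFData

/-! ### The approximation condition -/

theorem measure_le_of_ae_eventually_mem {α : Type*} [MeasurableSpace α] {μ : Measure α} {A : Set α}
    {Z : ℕ → Set α} (h : ∀ᵐ x ∂μ, x ∈ A → ∀ᶠ m in atTop, x ∈ Z m) {ε : ℝ≥0∞}
    (hε : ∀ᶠ m in atTop, μ (Z m) ≤ ε) : μ A ≤ ε := by
  obtain ⟨M, hM⟩ := eventually_atTop.1 hε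
  have hmono : Monotone fun N => ⋂ m, ⋂ _ : N ≤ m, Z m := fun N N' h =>
    Set.iInter_mono fun m => Set.iInter_mono' fun hm => ⟨h.trans hm, le_rfl⟩
  calc μ A ≤ μ (⋃ N, ⋂ m, ⋂ _ : N ≤ m, Z m) := measure_mono_ae <| by
        filter_upwards [h] with x hx hxA
        obtain ⟨N, hN⟩ := eventually_atTop.1 (hx hxA)
        exact Set.mem_iUnion.2 ⟨N, Set.mem_iInter₂.2 hN⟩
    _ = ⨆ N, μ (⋂ m, ⋂ _ : N ≤ m, Z m) := hmono.measure_iUnion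
    _ ≤ ε := iSup_le fun N => (measure_mono (Set.iInter₂_subset _ (le_max_right M N))).trans
        (hM _ (le_max_left M N))

section Preimage

variable {X Y : Type*} [mX : MeasurableSpace X] [MeasurableSpace Y] {μ : Measure X} {π : X → Y}

theorem exists_ae_eq_preimage_of_approx {A : Set X}
    (h : ∀ ε : ℝ≥0∞, 0 < ε → ∃ B, MeasurableSet B ∧ μ (symmDiff A (π ⁻¹' B)) ≤ ε) :
    ∃ B, MeasurableSet B ∧ A =ᵐ[μ] π ⁻¹' B := by
  choose B hB hle using fun k : ℕ => h (2⁻¹ ^ k) (ENNReal.pow_pos (by simp) k)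
  refine ⟨{y | ∀ᶠ k in atTop, y ∈ B k}, measurableSet_setOf_eventually hB, ?_⟩
  have hsum : ∑' k, μ (symmDiff A (π ⁻¹' B k)) ≠ ∞ := by
    refine ne_top_of_le_ne_top ?_ (ENNReal.tsum_le_tsum hle)
    rw [ENNReal.tsum_geometric, ENNReal.one_sub_inv_two, inv_inv]
    exact ENNReal.ofNat_ne_top
  filter_upwards [ae_eventually_notMem hsum] with x hx
  have hmem : ∀ᶠ k in atTop, (π x ∈ B k ↔ x ∈ A) := by
    filter_upwards [hx] with k hk
    rw [Set.mem_symmDiff, Set.mem_preimage] at hk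
    tauto
  exact propext ((eventually_congr hmem).trans eventually_const).symm

theorem exists_ae_eq_preimage_of_generateFrom {𝒮 : Set (Set X)}
    (hgen : mX = MeasurableSpace.generateFrom 𝒮)
    (h : ∀ A ∈ 𝒮, ∃ B, MeasurableSet B ∧ A =ᵐ[μ] π ⁻¹' B) {A : Set X} (hA : MeasurableSet A) :
    ∃ B, MeasurableSet B ∧ A =ᵐ[μ] π ⁻¹' B := by
  have hle : mX ≤ eventuallyMeasurableSpace (MeasurableSpace.comap π inferInstance) (ae μ) := by
    refine hgen.le.trans (MeasurableSpace.generateFrom_le fun A hA => ?_)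
    obtain ⟨B, hB, hAB⟩ := h A hA
    exact ⟨_, ⟨B, hB, rfl⟩, hAB⟩
  obtain ⟨_, ⟨B, hB, rfl⟩, hAB⟩ := hle A hA
  exact ⟨B, hB, hAB⟩

end Preimage

namespace OdometerSpace

theorem exists_measure_symmDiff_preimage_coord_le {G : Type*} [Group G] [MeasurableSpace G]
    [DiscreteMeasurableSpace G] {Γ : ℕ → Subgroup G} {X : Type*} [MeasurableSpace X] {μ : Measure X}
    [IsFiniteMeasure μ] {π : X → OdometerSpace Γ} (hπ : Measurable π) {A : Set X}
    (hA : ∃ B, MeasurableSet B ∧ A =ᵐ[μ] π ⁻¹' B) {ε : ℝ≥0∞} (hε : 0 < ε) :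
    ∃ (l : ℕ) (D : Set (G ⧸ Γ l)), μ (symmDiff A {x | (π x).coord l ∈ D}) ≤ ε := by
  obtain ⟨B, hB, hAB⟩ := hA
  obtain ⟨l, D, hD⟩ := exists_measure_symmDiff_coord_le (μ.map π) hB hε
  have hDm : MeasurableSet {y : OdometerSpace Γ | y.coord l ∈ D} :=
    measurable_coord l MeasurableSet.of_discrete
  rw [Measure.map_apply hπ (hB.symmDiff hDm)] at hD
  exact ⟨l, D, (measure_congr (hAB.symmDiff (ae_eq_refl _))).trans_le hD⟩

end OdometerSpace

namespace CFData

variable {G : Type*} [Group G] [MeasurableSpace G] [DiscreteMeasurableSpace G] [Countable G]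
  {P : CFData G} {Γ : ℕ → Subgroup G} {hP : P.IsAdmissible} {π : P.Space → OdometerSpace Γ}

theorem ν_symmDiff_blockSet (hP : P.IsAdmissible) {n m : ℕ} (h : n ≤ m) (S : Set G) :
    P.ν m (symmDiff (blockSet P.C n m) {f | f ∈ P.F m ∧ f ∈ S}) =
      P.measure hP (symmDiff (P.box n 1) (P.level m ∩ P.coord m ⁻¹' S)) := by
  rw [← measure_level_inter_coord hP, box_one_eq hP h]
  congr 1
  ext x
  have hF := coord_mem_F hP m x
  simp only [Set.mem_inter_iff, Set.mem_preimage, Set.mem_symmDiff, Set.mem_ofPred_eq]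
  tauto

theorem approximationFails_telescope_iff (hP : P.IsAdmissible) {q : ℕ → ℕ} (hq : Monotone q) :
    (P.telescope q).ApproximationFails Γ ↔ ∃ n, 0 < n ∧ ∃ ε : ℝ≥0∞, 0 < ε ∧
      ∀ (l : ℕ) (D : Set (G ⧸ Γ l)) (M : ℕ), n < M → ∃ m, M < m ∧ ε < P.measure hP
        (symmDiff (P.box (q n) 1) (P.level (q m) ∩ {x | (P.coord (q m) x : G ⧸ Γ l) ∈ D})) := by
  refine exists_congr fun n => and_congr_right fun _ => exists_congr fun ε =>
    and_congr_right fun _ => forall₄_congr fun l D M hM => exists_congr fun m =>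
      and_congr_right fun hm => ?_
  have hnm : n ≤ m := (hM.trans hm).le
  have hν := ν_symmDiff_blockSet hP (hq hnm) {f : G | (f : G ⧸ Γ l) ∈ D}
  rw [← blockSet_comp _ hq hnm] at hν
  exact hν ▸ Iff.rfl

theorem exists_measure_symmDiff_limitMap_le (hP : P.IsAdmissible) (hΓ : Antitone Γ) {q : ℕ → ℕ}
    (hq : StrictMono q) (hc : (P.telescope q).IsCompatible Γ)
    (hA : ¬ (P.telescope q).ApproximationFails Γ) {n : ℕ} (hn : 0 < n) {ε : ℝ≥0∞} (hε : 0 < ε) :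
    ∃ B, MeasurableSet B ∧
      P.measure hP (symmDiff (P.box (q n) 1) (P.limitMap hΓ q ⁻¹' B)) ≤ ε := by
  rw [approximationFails_telescope_iff hP hq.monotone] at hA
  push Not at hA
  obtain ⟨l, D, M, -, hD⟩ := hA n hn ε hε
  refine ⟨{y | y.coord l ∈ D}, OdometerSpace.measurable_coord l MeasurableSet.of_discrete,
    measure_le_of_ae_eventually_mem ?_ ((eventually_gt_atTop M).mono hD)⟩
  filter_upwards [ae_stabilizes hP hΓ hq hc] with x hx hxA
  filter_upwards [hx.eventually_eq hΓ l, hq.tendsto_atTop.eventually (eventually_mem_level hP x)]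
    with m hm hlevel
  have hmem : x ∈ P.level (q m) ∩ {x | (P.coord (q m) x : G ⧸ Γ l) ∈ D} ↔
      x ∈ P.limitMap hΓ q ⁻¹' {y | y.coord l ∈ D} := by
    rw [Set.mem_inter_iff, and_iff_right hlevel, Set.mem_ofPred_eq, hm]
    rfl
  rwa [Set.mem_symmDiff, hmem]

theorem exists_ae_eq_preimage_box
    (he : ∀ g : G, ∀ᵐ x ∂P.measure hP, π (P.T g x) = g • π x) {n : ℕ}
    (h : ∃ B, MeasurableSet B ∧ P.box n 1 =ᵐ[P.measure hP] π ⁻¹' B) (f : G) :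
    ∃ B, MeasurableSet B ∧ P.box n f =ᵐ[P.measure hP] π ⁻¹' B := by
  by_cases hf : f ∈ P.F n
  · obtain ⟨B, hB, hBbox⟩ := h
    refine ⟨(fun y => f⁻¹ • y) ⁻¹' B, OdometerSpace.measurable_smul f⁻¹ hB, ?_⟩
    filter_upwards [he f⁻¹, (quasiMeasurePreserving_T hP f⁻¹).ae hBbox, ae_mem_dom hP f⁻¹]
      with x hx hTx hdom
    have hmem : P.T f⁻¹ x ∈ P.box n 1 ↔ x ∈ P.box n f := by
      simpa using T_mem_box_iff_of_mem_F hP hdom (hP.one_mem_F n) (by simpa using hf)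
    have hB : P.T f⁻¹ x ∈ π ⁻¹' B ↔ x ∈ π ⁻¹' ((fun y => f⁻¹ • y) ⁻¹' B) := by
      simp only [Set.mem_preimage, hx]
    exact propext (hmem.symm.trans (hTx.to_iff.trans hB))
  · exact ⟨∅, MeasurableSet.empty, by rw [box_eq_empty hf, Set.preimage_empty]; exact ae_eq_refl _⟩

theorem exists_ae_eq_preimage_limitMap (hP : P.IsAdmissible) (hΓ : Antitone Γ) {q : ℕ → ℕ}
    (hq : StrictMono q) (hc : (P.telescope q).IsCompatible Γ)
    (hA : ¬ (P.telescope q).ApproximationFails Γ) {A : Set P.Space} (hAm : MeasurableSet A) :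
    ∃ B, MeasurableSet B ∧ A =ᵐ[P.measure hP] P.limitMap hΓ q ⁻¹' B := by
  have hcofinal : IsCofinal (Set.range fun n => q (n + 1)) :=
    isCofinal_range_of_strictMono fun _ _ h => hq (Nat.add_lt_add_right h 1)
  refine exists_ae_eq_preimage_of_generateFrom (generateFrom_box hP hcofinal) ?_ hAm
  rintro _ ⟨_, ⟨n, rfl⟩, f, rfl⟩
  exact exists_ae_eq_preimage_box (ae_limitMap_T hP hΓ hq hc)
    (exists_ae_eq_preimage_of_approx fun ε hε =>
      exists_measure_symmDiff_limitMap_le hP hΓ hq hc hA n.succ_pos hε) f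

theorem isFiniteMeasure_measure (hP : P.IsAdmissible) (h : (⨆ n, P.ν n (P.F n)) < ∞) :
    IsFiniteMeasure (P.measure hP) := by
  refine ⟨?_⟩
  rw [← iUnion_level hP, (level_mono hP).measure_iUnion]
  simpa only [measure_level] using h

theorem measure_level_inter_coord_ne_smul (hπ : Measurable π)
    (he : ∀ g : G, ∀ᵐ x ∂P.measure hP, π (P.T g x) = g • π x) (n l : ℕ) (a : G ⧸ Γ l) :
    P.measure hP (P.level n ∩ {x | (π x).coord l ≠ P.coord n x • a}) =
      P.defect hP π n l a * P.measure hP (P.level n) := by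
  have hmeas : MeasurableSet {x | (π x).coord l ≠ P.coord n x • a} :=
    ((measurable_coord hP n).prodMk ((OdometerSpace.measurable_coord l).comp hπ))
      (MeasurableSet.of_discrete (s := {p : G × (G ⧸ Γ l) | p.2 ≠ p.1 • a}))
  have hbox (f : G) : P.measure hP (P.box n f ∩ {x | (π x).coord l ≠ P.coord n x • a}) =
      P.defect hP π n l a * P.ν n {f} := by
    by_cases hf : f ∈ P.F n
    · rw [← measure_box_inter_ne hπ he hf]
      congr 1
      ext x
      exact and_congr_right fun hx => by simp only [Set.mem_ofPred_eq, coord_eq hP hx]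
    · rw [box_eq_empty hf, Set.empty_inter, measure_empty, hP.ν_eq_zero hf, mul_zero]
  have h := measure_level_inter_coord_inter hP n Set.univ hmeas
  simp only [hbox, ENNReal.tsum_mul_left, ← measure_eq_tsum_singleton] at h
  rwa [← measure_level_inter_coord hP n Set.univ, Set.preimage_univ, Set.inter_univ] at h

theorem measure_symmDiff_box_one_le (hπ : Measurable π)
    (he : ∀ g : G, ∀ᵐ x ∂P.measure hP, π (P.T g x) = g • π x) {n m : ℕ} (h : n ≤ m)
    (y : OdometerSpace Γ) (l : ℕ) (D : Set (G ⧸ Γ l)) :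
    P.measure hP (symmDiff (P.box n 1) (P.level m ∩ {x | P.coord m x • y.coord l ∈ D})) ≤
      P.measure hP (symmDiff (P.box n 1) {x | (π x).coord l ∈ D}) +
        P.defect hP π m l (y.coord l) * P.measure hP (P.level m) := by
  rw [← measure_level_inter_coord_ne_smul hπ he]
  refine (measure_mono fun x hx => ?_).trans (measure_union_le _ _)
  have hlevel : x ∈ P.level m := hx.elim (fun hx => level_mono hP h ⟨1, hx.1⟩) fun hx => hx.1.1
  by_cases hxl : (π x).coord l = P.coord m x • y.coord l
  · refine Or.inl ?_
    have hmem : x ∈ P.level m ∩ {x | P.coord m x • y.coord l ∈ D} ↔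
        x ∈ {x | (π x).coord l ∈ D} := by
      rw [Set.mem_inter_iff, and_iff_right hlevel, Set.mem_ofPred_eq, ← hxl]
      rfl
    rwa [Set.mem_symmDiff, hmem] at hx
  · exact Or.inr ⟨hlevel, hxl⟩

theorem not_approximationFails_stab [IsFiniteMeasure (P.measure hP)] (hπ : Measurable π)
    (he : ∀ g : G, ∀ᵐ x ∂P.measure hP, π (P.T g x) = g • π x)
    (hgen : ∀ A, MeasurableSet A → ∃ B, MeasurableSet B ∧ A =ᵐ[P.measure hP] π ⁻¹' B)
    {y : OdometerSpace Γ} {q : ℕ → ℕ} (hq : StrictMono q)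
    (hd : ∀ l, Tendsto (fun k => P.defect hP π (q k) l (y.coord l)) atTop (𝓝 0)) :
    ¬ (P.telescope q).ApproximationFails y.stab := by
  rw [approximationFails_telescope_iff hP hq.monotone]
  rintro ⟨n, -, ε, hε, hfails⟩
  have hε2 : 0 < ε / 2 := ENNReal.half_pos hε.ne'
  obtain ⟨l, D, hD⟩ :=
    OdometerSpace.exists_measure_symmDiff_preimage_coord_le hπ
      (hgen _ (measurableSet_box (q n) 1)) hε2
  have hlim : Tendsto (fun k => P.defect hP π (q k) l (y.coord l) * P.measure hP Set.univ)
      atTop (𝓝 0) := by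
    simpa using ENNReal.Tendsto.mul_const (hd l) (Or.inr (measure_ne_top (P.measure hP) Set.univ))
  obtain ⟨M, hM⟩ := eventually_atTop.1 (ENNReal.tendsto_nhds_zero.1 hlim _ hε2)
  obtain ⟨m, hm, hlt⟩ := hfails l (MulAction.ofQuotientStabilizer G (y.coord l) ⁻¹' D)
    (max M (n + 1)) (lt_max_of_lt_right n.lt_succ_self)
  refine hlt.not_ge ?_
  calc _ ≤ P.measure hP (symmDiff (P.box (q n) 1) {x | (π x).coord l ∈ D}) +
        P.defect hP π (q m) l (y.coord l) * P.measure hP (P.level (q m)) :=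
        measure_symmDiff_box_one_le hπ he (hq.monotone (by omega)) y l D
    _ ≤ ε / 2 + ε / 2 := add_le_add hD <|
        (mul_le_mul_right (measure_mono (Set.subset_univ _)) _).trans (hM m (by omega))
    _ = ε := ENNReal.add_halves ε

theorem exists_equivariant_of_isCompatible (hP : P.IsAdmissible) (hΓ : Antitone Γ) {q : ℕ → ℕ}
    (hq : StrictMono q) (hc : (P.telescope q).IsCompatible Γ) :
    ∃ π : P.Space → OdometerSpace Γ, Measurable π ∧
      (∀ g : G, ∀ᵐ x ∂P.measure hP, π (P.T g x) = g • π x) ∧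
      (¬ (P.telescope q).ApproximationFails Γ →
        ∀ A, MeasurableSet A → ∃ B, MeasurableSet B ∧ A =ᵐ[P.measure hP] π ⁻¹' B) :=
  ⟨P.limitMap hΓ q, measurable_limitMap hP hΓ q, ae_limitMap_T hP hΓ hq hc,
    fun hA _ => exists_ae_eq_preimage_limitMap hP hΓ hq hc hA⟩

theorem exists_isCompatible_telescope_stab (hΓ : ∀ n, (Γ n).FiniteIndex)
    {π : P.Space → OdometerSpace Γ} (hπ : Measurable π)
    (he : ∀ g : G, ∀ᵐ x ∂P.measure hP, π (P.T g x) = g • π x) :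
    ∃ (y : OdometerSpace Γ) (q : ℕ → ℕ), q 0 = 0 ∧ StrictMono q ∧
      (P.telescope q).IsCompatible y.stab ∧
      ∀ l, Tendsto (fun k => P.defect hP π (q k) l (y.coord l)) atTop (𝓝 0) := by
  obtain ⟨y, q, hq0, hq, hd⟩ := exists_telescoping_defect_le hΓ hπ he
  refine ⟨y, q, hq0, hq, isCompatible_telescope_stab hπ he hq.monotone hd, fun l => ?_⟩
  have hpow : Tendsto (fun k : ℕ => (2⁻¹ : ℝ≥0∞) ^ (k + 1)) atTop (𝓝 0) :=
    (ENNReal.tendsto_pow_atTop_nhds_zero_of_lt_one (by simp)).comp (tendsto_add_atTop_nat 1)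
  refine tendsto_of_tendsto_of_tendsto_of_le_of_le' tendsto_const_nhds hpow
    (Eventually.of_forall fun _ => zero_le) ?_
  filter_upwards [eventually_ge_atTop (max 1 l)] with k hk
  exact hd k (le_of_max_le_left hk) l (le_of_max_le_right hk)

theorem HasFactor.exists_isCompatible {ν : Measure (OdometerSpace Γ)}
    (h : P.HasFactor hP Γ ν) (hΓ : IsOdometerSequence Γ) :
    ∃ (Γ' : ℕ → Subgroup G) (q : ℕ → ℕ), IsOdometerSequence Γ' ∧ q 0 = 0 ∧ StrictMono q ∧
      (P.telescope q).IsCompatible Γ' := by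
  obtain ⟨π, hπ, he, -⟩ := h
  obtain ⟨y, q, hq0, hq, hc, -⟩ := exists_isCompatible_telescope_stab hΓ.finiteIndex hπ he
  exact ⟨y.stab, q, y.isOdometerSequence_stab hΓ, hq0, hq, hc⟩

theorem IsIsomorphicTo.exists_not_approximationFails [IsFiniteMeasure (P.measure hP)]
    {ν : Measure (OdometerSpace Γ)} (h : P.IsIsomorphicTo hP Γ ν) (hΓ : IsOdometerSequence Γ) :
    ∃ (Γ' : ℕ → Subgroup G) (q : ℕ → ℕ), IsOdometerSequence Γ' ∧ q 0 = 0 ∧ StrictMono q ∧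
      (P.telescope q).IsCompatible Γ' ∧ ¬ (P.telescope q).ApproximationFails Γ' := by
  obtain ⟨π, σ, hπ, hσ, hσπ, -, he, -⟩ := h
  obtain ⟨y, q, hq0, hq, hc, hd⟩ := exists_isCompatible_telescope_stab hΓ.finiteIndex hπ he
  refine ⟨y.stab, q, y.isOdometerSequence_stab hΓ, hq0, hq, hc,
    not_approximationFails_stab hπ he (fun A hA => ⟨σ ⁻¹' A, hσ hA, ?_⟩) hq hd⟩
  filter_upwards [hσπ] with x hx
  exact propext (iff_of_eq (congrArg (· ∈ A) hx.symm))

end CFData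

theorem corollary4p6 {G : Type*} [Group G] [Countable G] [MeasurableSpace G]
    [DiscreteMeasurableSpace G] (P : CFData G) (hP : P.IsAdmissible) :
    -- the criterion for having no odometer factor
    ((¬ ∃ (Γ : ℕ → Subgroup G) (ν : Measure (OdometerSpace Γ)),
        IsOdometerSequence Γ ∧ IsNonsingularOdometer Γ ν ∧ P.HasFactor hP Γ ν) ↔
      ∀ Γ : ℕ → Subgroup G, IsOdometerSequence Γ →
        ∀ q : ℕ → ℕ, q 0 = 0 → StrictMono q → ¬ (P.telescope q).IsCompatible Γ) ∧
    -- the same for factors with a non-atomic measure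
    ((∀ Γ : ℕ → Subgroup G, IsOdometerSequence Γ → (⋂ n, (Γ n : Set G)).Finite) →
      ((¬ ∃ (Γ : ℕ → Subgroup G) (ν : Measure (OdometerSpace Γ)),
          IsOdometerSequence Γ ∧ IsNonsingularOdometer Γ ν ∧ NullSingletonClass ν ∧
            P.HasFactor hP Γ ν) ↔
        ∀ Γ : ℕ → Subgroup G, IsOdometerSequence Γ →
          ∀ q : ℕ → ℕ, q 0 = 0 → StrictMono q → ¬ (P.telescope q).IsCompatible Γ)) ∧
    -- the criterion for not being isomorphic to an odometer
    ((¬ ∃ (Γ : ℕ → Subgroup G) (ν : Measure (OdometerSpace Γ)),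
        IsOdometerSequence Γ ∧ IsNonsingularOdometer Γ ν ∧ P.IsIsomorphicTo hP Γ ν) →
      ∀ Γ : ℕ → Subgroup G, IsOdometerSequence Γ →
        ∀ q : ℕ → ℕ, q 0 = 0 → StrictMono q → (P.telescope q).IsCompatible Γ →
          (P.telescope q).ApproximationFails Γ) ∧
    ((⨆ n, P.ν n (P.F n)) < ∞ →
      (∀ Γ : ℕ → Subgroup G, IsOdometerSequence Γ →
        ∀ q : ℕ → ℕ, q 0 = 0 → StrictMono q → (P.telescope q).IsCompatible Γ →
          (P.telescope q).ApproximationFails Γ) →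
      ¬ ∃ (Γ : ℕ → Subgroup G) (ν : Measure (OdometerSpace Γ)),
        IsOdometerSequence Γ ∧ IsNonsingularOdometer Γ ν ∧ P.IsIsomorphicTo hP Γ ν) := by
  refine ⟨⟨?_, ?_⟩, fun hfin => ⟨?_, ?_⟩, ?_, ?_⟩
  · intro h Γ hΓ q _ hq hc
    obtain ⟨π, hπ, he, -⟩ :=
      CFData.exists_equivariant_of_isCompatible hP hΓ.strictAnti.antitone hq hc
    exact h ⟨Γ, _, hΓ, CFData.isNonsingularOdometer_map hP hπ he, CFData.hasFactor_map hP hπ he⟩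
  · rintro h ⟨Γ, ν, hΓ, -, hfactor⟩
    obtain ⟨Γ', q, hΓ', hq0, hq, hc⟩ := hfactor.exists_isCompatible hΓ
    exact h Γ' hΓ' q hq0 hq hc
  · intro h Γ hΓ q _ hq hc
    obtain ⟨π, hπ, he, -⟩ :=
      CFData.exists_equivariant_of_isCompatible hP hΓ.strictAnti.antitone hq hc
    exact h ⟨Γ, _, hΓ, CFData.isNonsingularOdometer_map hP hπ he, CFData.nullSingletonClass_map
      hπ he fun y => hfin _ (y.isOdometerSequence_stab hΓ), CFData.hasFactor_map hP hπ he⟩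
  · rintro h ⟨Γ, ν, hΓ, -, -, hfactor⟩
    obtain ⟨Γ', q, hΓ', hq0, hq, hc⟩ := hfactor.exists_isCompatible hΓ
    exact h Γ' hΓ' q hq0 hq hc
  · intro h Γ hΓ q _ hq hc
    obtain ⟨π, hπ, he, hgen⟩ :=
      CFData.exists_equivariant_of_isCompatible hP hΓ.strictAnti.antitone hq hc
    exact not_not.1 fun hA => h ⟨Γ, _, hΓ, CFData.isNonsingularOdometer_map hP hπ he,
      CFData.isIsomorphicTo_map hπ he (hgen hA)⟩
  · rintro hμ h ⟨Γ, ν, hΓ, -, hiso⟩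
    have := CFData.isFiniteMeasure_measure hP hμ
    obtain ⟨Γ', q, hΓ', hq0, hq, hc, hA⟩ := hiso.exists_not_approximationFails hΓ
    exact hA (h Γ' hΓ' q hq0 hq hc)
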